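/- Let $k$ be an algebraically closed field of characteristic $2$, let $G$ be an algebraic group of type $E_8$ over $k$, and let $\mathfrak g=\mathrm{Lie}(G)=\mathfrak g_{\mathbb Z}\otimes_{\mathbb Z}k$, where $\mathfrak g_{\mathbb Z}$ is the $\mathbb Z$-span of a Chevalley basis $\{e_\alpha:\alpha\in\Phi\}\cup\{h_1,\dots,h_8\}$ of the complex simple Lie algebra of type $E_8$. Number the simple roots $\alpha_1,\dots,\alpha_8$ as in Bourbaki (so $\alpha_2$ is the node attached to $\alpha_4$, and $\alpha_1,\alpha_3,\alpha_4,\alpha_5,\alpha_6,\alpha_7,\alpha_8$ form a chain). For a root $\alpha=\sum_i a_i\alpha_i$ write $e_{a_1a_2\cdots a_8}$ for $e_\alpha$, and for positive $\alpha$ write $f_{a_1a_2\cdots a_8}$ for $e_{-\alpha}$. Put $$e_1=e_{10000000}+e_{01000000}+e_{00100000}+e_{01010000}+e_{00011000}+e_{00001100}+e_{00000110}+e_{00000001},$$ $$f_1=f_{11222110}+f_{11122111}+f_{11232110}+f_{11222210}+f_{11221111}+f_{12232100}+f_{01122221},$$ $$e_2=e_{10100000}+e_{01010000}+e_{00110000}+e_{00011000}+e_{00001100}+e_{00000110}+e_{00000011}+e_{00111000},$$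 $$f_2=f_{11232211}+f_{22343221}+f_{12343321}+f_{12244321}$$ (the elements $e_1$ and $e_2$ are the standard representatives of the nilpotent orbits usually labelled $E_8(a_2)$ and $E_8(a_4)$). For $i=1,2$ let $L_i=\langle e_i,f_i\rangle$ be the Lie subalgebra of $\mathfrak g$ generated by $e_i$ and $f_i$. Then, for $i=1,2$, $L_i$ is a maximal (proper) subalgebra of $\mathfrak g$, $\dim_k L_i=124$, and $\mathfrak g/L_i$ is an irreducible $L_i$-module. -/

import Mathlib

open scoped TensorProduct

namespace E8

/-- The root lattice of type `E₈`: the entry `x i` is the coefficient of the simple root with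
Bourbaki number `i + 1`. As `E₈` is simply laced, `∑ xᵢ αᵢ ↦ ∑ xᵢ αᵢ^∨` identifies it with the
coroot lattice. -/
abbrev Lattice : Type := Fin 8 → ℤ

/-- The invariant form, normalised by `(α | α) = 2` for the roots; it is given by the
Cartan matrix. -/
def form (x y : Lattice) : ℤ := x ⬝ᵥ (CartanMatrix.E₈.mulVec y)

/-- The roots of `E₈`: the vectors of norm `2` of the root lattice. -/
abbrev Root : Type := {x : Lattice // form x x = 2}

/-- The upper triangular half of the Cartan matrix. -/
def halfMatrix : Matrix (Fin 8) (Fin 8) ℤ :=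
  Matrix.of fun i j => if i = j then 1 else if i < j then CartanMatrix.E₈ i j else 0

/-- A bilinear form with `half x y + half y x = form x y`. -/
def half (x y : Lattice) : ℤ := x ⬝ᵥ (halfMatrix.mulVec y)

/-- The bimultiplicative sign function `ε` with `ε(α, α) = -1` for all roots and
`ε(x, y) ε(y, x) = (-1) ^ (x | y)`, giving the signs of the structure constants. -/
def sign (x y : Lattice) : ℤ := ((half x y).negOnePow : ℤ)

/-- The underlying group of the Chevalley `ℤ`-form of the Lie algebra of type `E₈`: the coroot
lattice plus the free abelian group on the root vectors. -/
def IntegralForm : Type := Lattice × (Root →₀ ℤ)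

theorem form_add_left (x y z : Lattice) : form (x + y) z = form x z + form y z := by
  simp [form, add_dotProduct]

theorem form_add_right (x y z : Lattice) : form x (y + z) = form x y + form x z := by
  simp [form, Matrix.mulVec_add, dotProduct_add]

theorem form_neg_left (x y : Lattice) : form (-x) y = -form x y := by
  simp [form]

theorem form_neg_right (x y : Lattice) : form x (-y) = -form x y := by
  simp [form, Matrix.mulVec_neg]

theorem form_zero_right (x : Lattice) : form x 0 = 0 := by
  simp [form]

theorem half_add_left (x y z : Lattice) : half (x + y) z = half x z + half y z := by
  simp [half, add_dotProduct]

theorem half_add_right (x y z : Lattice) : half x (y + z) = half x y + half x z := by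
  simp [half, Matrix.mulVec_add, dotProduct_add]

theorem half_add_half (x y : Lattice) : half x y + half y x = form x y := by
  have h : CartanMatrix.E₈ = halfMatrix + halfMatrix.transpose := by decide
  rw [form, h, Matrix.add_mulVec, dotProduct_add, half, half, Matrix.mulVec_transpose,
    dotProduct_comm x (Matrix.vecMul y halfMatrix), Matrix.dotProduct_mulVec y]

theorem form_comm (x y : Lattice) : form x y = form y x := by
  rw [← half_add_half, ← half_add_half, add_comm]

theorem form_add_self (x y : Lattice) :
    form (x + y) (x + y) = form x x + form y y + 2 * form x y := by
  rw [form_add_left, form_add_right, form_add_right, form_comm y x]; ring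

theorem form_self_sq (x : Lattice) : 60 * form x x =
    30 * (2 * x 0 - x 2) ^ 2 + 30 * (2 * x 1 - x 3) ^ 2 + 10 * (3 * x 2 - 2 * x 3) ^ 2
      + 2 * (5 * x 3 - 6 * x 4) ^ 2 + 3 * (4 * x 4 - 5 * x 5) ^ 2 + 5 * (3 * x 5 - 4 * x 6) ^ 2
      + 10 * (2 * x 6 - 3 * x 7) ^ 2 + 30 * x 7 ^ 2 := by
  simp [form, CartanMatrix.E₈, dotProduct, Matrix.mulVec, Fin.sum_univ_succ]
  ring

theorem form_self_nonneg (x : Lattice) : 0 ≤ form x x := by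
  have := form_self_sq x
  have : 0 ≤ 60 * form x x := by rw [this]; positivity
  omega

theorem eq_zero_of_form_self (x : Lattice) (h : form x x = 0) : x = 0 := by
  have e := form_self_sq x
  rw [h] at e
  have h0 := sq_nonneg (2 * x 0 - x 2)
  have h1 := sq_nonneg (2 * x 1 - x 3)
  have h2 := sq_nonneg (3 * x 2 - 2 * x 3)
  have h3 := sq_nonneg (5 * x 3 - 6 * x 4)
  have h4 := sq_nonneg (4 * x 4 - 5 * x 5)
  have h5 := sq_nonneg (3 * x 5 - 4 * x 6)
  have h6 := sq_nonneg (2 * x 6 - 3 * x 7)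
  have h7 := sq_nonneg (x 7)
  have k0 : 2 * x 0 - x 2 = 0 := pow_eq_zero_iff two_ne_zero |>.1 (by linarith)
  have k1 : 2 * x 1 - x 3 = 0 := pow_eq_zero_iff two_ne_zero |>.1 (by linarith)
  have k2 : 3 * x 2 - 2 * x 3 = 0 := pow_eq_zero_iff two_ne_zero |>.1 (by linarith)
  have k3 : 5 * x 3 - 6 * x 4 = 0 := pow_eq_zero_iff two_ne_zero |>.1 (by linarith)
  have k4 : 4 * x 4 - 5 * x 5 = 0 := pow_eq_zero_iff two_ne_zero |>.1 (by linarith)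
  have k5 : 3 * x 5 - 4 * x 6 = 0 := pow_eq_zero_iff two_ne_zero |>.1 (by linarith)
  have k6 : 2 * x 6 - 3 * x 7 = 0 := pow_eq_zero_iff two_ne_zero |>.1 (by linarith)
  have k7 : x 7 = 0 := pow_eq_zero_iff two_ne_zero |>.1 (by linarith)
  ext i
  fin_cases i <;> simp <;> omega

theorem neg_two_le_form {x y : Lattice} (hx : form x x = 2) (hy : form y y = 2) :
    -2 ≤ form x y := by
  have := form_self_nonneg (x + y)
  rw [form_add_self] at this
  omega

theorem add_eq_zero_iff_form {x y : Lattice} (hx : form x x = 2) (hy : form y y = 2) :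
    x + y = 0 ↔ form x y = -2 := by
  refine ⟨fun h => ?_, fun h => eq_zero_of_form_self _ (by rw [form_add_self]; omega)⟩
  rw [← neg_eq_of_add_eq_zero_right h, form_neg_right, hx]

theorem add_root_iff_form {x y : Lattice} (hx : form x x = 2) (hy : form y y = 2) :
    form (x + y) (x + y) = 2 ↔ form x y = -1 := by
  rw [form_add_self]
  omega

theorem form_disjoint_nonpos (x y : Lattice) (hx : 0 ≤ x) (hy : 0 ≤ y) (h : ∀ i, x i * y i = 0) :
    form x y ≤ 0 := by
  simp only [form, dotProduct, Matrix.mulVec, Finset.mul_sum]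
  refine Finset.sum_nonpos fun i _ => Finset.sum_nonpos fun j _ => ?_
  by_cases hij : i = j
  · subst hij
    rw [mul_left_comm, h, mul_zero]
  · rw [mul_left_comm]
    exact mul_nonpos_of_nonpos_of_nonneg (CartanMatrix.E₈_off_diag_nonpos i j hij)
      (mul_nonneg (hx i) (hy j))

/-- Every root is positive or negative. -/
theorem nonneg_or_nonpos {x : Lattice} (hx : form x x = 2) : 0 ≤ x ∨ 0 ≤ -x := by
  by_contra! hc
  have hp : x⁺ ≠ 0 := fun h => hc.2 (by rwa [posPart_eq_zero, ← neg_nonneg] at h)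
  have hn : x⁻ ≠ 0 := fun h => hc.1 (by rwa [negPart_eq_zero] at h)
  have h1 := form_disjoint_nonpos x⁺ x⁻ (posPart_nonneg x) (negPart_nonneg x) fun i => by
    rw [Pi.posPart_apply, Pi.negPart_apply, posPart_def, negPart_def]
    rcases le_total 0 (x i) with h | h <;> simp [h]
  have h2 : form x⁺ x⁺ ≠ 0 := fun h => hp (eq_zero_of_form_self _ h)
  have h3 : form x⁻ x⁻ ≠ 0 := fun h => hn (eq_zero_of_form_self _ h)
  have h4 := form_self_nonneg x⁺
  have h5 := form_self_nonneg x⁻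
  have h6 := half_add_half x⁺ x⁺
  have h7 := half_add_half x⁻ x⁻
  rw [← posPart_sub_negPart x, sub_eq_add_neg, form_add_self, form_neg_left, form_neg_right,
    form_neg_right] at hx
  omega

theorem sign_add_left (x y z : Lattice) : sign (x + y) z = sign x z * sign y z := by
  simp [sign, half_add_left, Int.negOnePow_add]

theorem sign_add_right (x y z : Lattice) : sign x (y + z) = sign x y * sign x z := by
  simp [sign, half_add_right, Int.negOnePow_add]

theorem sign_mul_self (x y : Lattice) : sign x y * sign x y = 1 := by
  simp [sign, ← Units.val_mul]

theorem sign_mul_swap (x y : Lattice) : sign x y * sign y x = (form x y).negOnePow := by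
  rw [← half_add_half, Int.negOnePow_add]
  simp [sign]

theorem sign_self {x : Lattice} (hx : form x x = 2) : sign x x = -1 := by
  have h := half_add_half x x
  have : half x x = 1 := by omega
  simp [sign, this]

theorem sign_swap_odd {x y : Lattice} (h : form x y = -1) : sign y x = -sign x y := by
  have h1 := sign_mul_swap x y
  have h2 := sign_mul_self x y
  rw [h] at h1
  have h3 : sign x y * sign y x = -1 := by simpa using h1
  linear_combination sign x y * h3 - sign y x * h2

theorem sign_swap_even {x y : Lattice} (h : form x y = 0) : sign y x = sign x y := by
  have h1 := sign_mul_swap x y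
  have h2 := sign_mul_self x y
  rw [h] at h1
  have h3 : sign x y * sign y x = 1 := by simpa using h1
  linear_combination sign x y * h3 - sign y x * h2

theorem sign_neg_left (x y : Lattice) : sign (-x) y = sign x y := by
  have h : half (-x) y = -half x y := by simp [half]
  simp [sign, h]

theorem sign_neg_right (x y : Lattice) : sign x (-y) = sign x y := by
  have h : half x (-y) = -half x y := by simp [half, Matrix.mulVec_neg]
  simp [sign, h]

/-- The opposite root. -/
instance : Neg Root := ⟨fun α => ⟨-α.1, by rw [form_neg_left, form_neg_right, neg_neg, α.2]⟩⟩

/-- The root with given coefficients `α₁, …, α₈` in the simple roots. -/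
def root (x : Lattice) (h : form x x = 2 := by decide) : Root := ⟨x, h⟩

namespace IntegralForm

noncomputable instance : AddCommGroup IntegralForm :=
  inferInstanceAs (AddCommGroup (Lattice × (Root →₀ ℤ)))

/-- The element `∑ xᵢ hᵢ` of the Cartan subalgebra. -/
def H (x : Lattice) : IntegralForm := (x, 0)

/-- The root vector attached to a root, before the normalisation of the signs. -/
noncomputable def X (α : Root) : IntegralForm := ((0 : Lattice), Finsupp.single α 1)

open scoped Classical in
/-- The bracket of two root vectors: `[X_α, X_{-α}] = -h_α`, `[X_α, X_β] = ε(α, β) X_{α+β}` if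
`α + β` is a root, and `[X_α, X_β] = 0` otherwise. -/
noncomputable def rootBracket (α β : Root) : IntegralForm :=
  if α.1 + β.1 = 0 then -H α.1
  else if h : form (α.1 + β.1) (α.1 + β.1) = 2 then sign α.1 β.1 • X ⟨α.1 + β.1, h⟩
  else 0

/-- The biadditive bracket with `[h, h'] = 0`, `[h, X_β] = β(h) X_β`, `[X_α, h] = -α(h) X_α`, and
with `rootBracket` on the root vectors. -/
noncomputable instance : Bracket IntegralForm IntegralForm where
  bracket x y :=
    (x.2.sum fun α a => y.2.sum fun β b => (a * b) • rootBracket α β)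
      + (y.2.sum fun β b => (b * form x.1 β.1) • X β)
      - (x.2.sum fun α a => (a * form y.1 α.1) • X α)

theorem H_add (x y : Lattice) : H (x + y) = H x + H y :=
  Prod.ext rfl (add_zero _).symm

theorem H_neg (x : Lattice) : H (-x) = -H x :=
  Prod.ext rfl neg_zero.symm

theorem bracket_def (x y : IntegralForm) : ⁅x, y⁆ =
    (x.2.sum fun α a => y.2.sum fun β b => (a * b) • rootBracket α β)
      + (y.2.sum fun β b => (b * form x.1 β.1) • X β)
      - (x.2.sum fun α a => (a * form y.1 α.1) • X α) := rfl

theorem add_bracket (x y z : IntegralForm) : ⁅x + y, z⁆ = ⁅x, z⁆ + ⁅y, z⁆ := by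
  have h1 : (x + y).1 = x.1 + y.1 := rfl
  have h2 : (x + y).2 = x.2 + y.2 := rfl
  simp only [bracket_def, h1, h2]
  rw [Finsupp.sum_add_index' (by simp) (by intros; simp [add_mul, add_smul, Finsupp.sum_add]),
    Finsupp.sum_add_index' (by simp) (by intros; simp [add_mul, add_smul])]
  simp only [form_add_left, mul_add, add_smul, Finsupp.sum_add]
  abel

theorem bracket_add (x y z : IntegralForm) : ⁅x, y + z⁆ = ⁅x, y⁆ + ⁅x, z⁆ := by
  have h1 : (y + z).1 = y.1 + z.1 := rfl
  have h2 : (y + z).2 = y.2 + z.2 := rfl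
  have h3 (α : Root) (a : ℤ) : ((y + z).2.sum fun β b => (a * b) • rootBracket α β) =
      (y.2.sum fun β b => (a * b) • rootBracket α β) +
        (z.2.sum fun β b => (a * b) • rootBracket α β) := by
    rw [h2, Finsupp.sum_add_index' (by simp) (by intros; simp [mul_add, add_smul])]
  simp only [bracket_def, h3]
  rw [h1, h2, Finsupp.sum_add_index' (by simp) (by intros; simp [add_mul, add_smul])]
  simp only [form_add_left, mul_add, add_smul, Finsupp.sum_add]
  abel

/-- The bracket as a biadditive map. -/
noncomputable def bracketHom : IntegralForm →+ IntegralForm →+ IntegralForm :=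
  AddMonoidHom.mk' (fun x => AddMonoidHom.mk' (fun y => ⁅x, y⁆) (bracket_add x))
    (fun x y => AddMonoidHom.ext fun z => add_bracket x y z)

theorem neg_bracket (x y : IntegralForm) : ⁅-x, y⁆ = -⁅x, y⁆ :=
  DFunLike.congr_fun (map_neg bracketHom x) y

theorem bracket_neg (x y : IntegralForm) : ⁅x, -y⁆ = -⁅x, y⁆ :=
  map_neg (bracketHom x) y

theorem zero_bracket (y : IntegralForm) : ⁅(0 : IntegralForm), y⁆ = 0 :=
  DFunLike.congr_fun (map_zero bracketHom) y

theorem bracket_zero (x : IntegralForm) : ⁅x, (0 : IntegralForm)⁆ = 0 :=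
  map_zero (bracketHom x)

theorem zsmul_bracket (n : ℤ) (x y : IntegralForm) : ⁅n • x, y⁆ = n • ⁅x, y⁆ :=
  DFunLike.congr_fun (map_zsmul bracketHom n x) y

theorem bracket_zsmul (n : ℤ) (x y : IntegralForm) : ⁅x, n • y⁆ = n • ⁅x, y⁆ :=
  map_zsmul (bracketHom x) n y

theorem H_fst (x : Lattice) : (H x).1 = x := rfl

theorem H_snd (x : Lattice) : (H x).2 = 0 := rfl

theorem X_fst (α : Root) : (X α).1 = 0 := rfl

theorem X_snd (α : Root) : (X α).2 = Finsupp.single α 1 := rfl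

theorem bracket_H_H (x y : Lattice) : ⁅H x, H y⁆ = 0 := by
  simp [bracket_def, H_snd]

theorem bracket_H_X (x : Lattice) (β : Root) : ⁅H x, X β⁆ = form x β.1 • X β := by
  simp [bracket_def, H_fst, H_snd, X_snd]

theorem bracket_X_H (α : Root) (y : Lattice) : ⁅X α, H y⁆ = -(form y α.1 • X α) := by
  simp [bracket_def, H_fst, H_snd, X_snd]

theorem bracket_X_X (α β : Root) : ⁅X α, X β⁆ = rootBracket α β := by
  have h (γ : Root) : form (0 : Lattice) γ.1 = 0 := by rw [form_comm, form_zero_right]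
  simp [bracket_def, X_fst, X_snd, h]

theorem induction {P : IntegralForm → Prop} (hadd : ∀ x y, P x → P y → P (x + y))
    (hneg : ∀ x, P x → P (-x)) (hH : ∀ x, P (H x)) (hX : ∀ α, P (X α)) (x : IntegralForm) :
    P x := by
  have h0 : P 0 := hH 0
  have hn (n : ℕ) (α : Root) : P (n • X α) := by
    induction n with
    | zero => simpa using h0
    | succ n ih => rw [succ_nsmul]; exact hadd _ _ ih (hX α)
  have hz (n : ℤ) (α : Root) : P (n • X α) := by
    rcases Int.eq_nat_or_neg n with ⟨m, rfl | rfl⟩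
    · rw [natCast_zsmul]; exact hn m α
    · rw [neg_smul, natCast_zsmul]; exact hneg _ (hn m α)
  let Y (s : Root →₀ ℤ) : IntegralForm := ((0 : Lattice), s)
  have hs (s : Root →₀ ℤ) : P (Y s) := by
    induction s using Finsupp.induction_linear with
    | zero => exact h0
    | add f g hf hg =>
      have : Y (f + g) = Y f + Y g := Prod.ext (add_zero _).symm rfl
      rw [this]; exact hadd _ _ hf hg
    | single α n =>
      have : Y (Finsupp.single α n) = n • X α :=
        Prod.ext (smul_zero n).symm (by
          change _ = n • Finsupp.single α (1 : ℤ)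
          simp [Y])
      rw [this]; exact hz n α
  have : x = H x.1 + Y x.2 := Prod.ext (add_zero _).symm (zero_add _).symm
  rw [this]; exact hadd _ _ (hH _) (hs _)

open scoped Classical in
/-- The root vector attached to a vector of the root lattice, zero if this is not a root. -/
noncomputable def V (x : Lattice) : IntegralForm := if h : form x x = 2 then X ⟨x, h⟩ else 0

theorem X_eq_V (α : Root) : X α = V α.1 := by
  rw [V, dif_pos α.2]

theorem V_eq_zero {x : Lattice} (h : form x x ≠ 2) : V x = 0 := by
  rw [V, dif_neg h]

theorem bracket_H_V (x y : Lattice) : ⁅H x, V y⁆ = form x y • V y := by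
  by_cases h : form y y = 2
  · rw [V, dif_pos h, bracket_H_X]
  · rw [V_eq_zero h, bracket_zero, smul_zero]

theorem bracket_V_H (x y : Lattice) : ⁅V x, H y⁆ = -(form y x • V x) := by
  by_cases h : form x x = 2
  · rw [V, dif_pos h, bracket_X_H]
  · rw [V_eq_zero h, zero_bracket, smul_zero, neg_zero]

theorem bracket_V_V {x y : Lattice} (hx : form x x = 2) (hy : form y y = 2)
    (h : form x y ≠ -2) : ⁅V x, V y⁆ = sign x y • V (x + y) := by
  have h' : ¬ x + y = 0 := by rwa [add_eq_zero_iff_form hx hy]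
  rw [V, dif_pos hx, V, dif_pos hy, bracket_X_X, rootBracket, if_neg h', V]
  split_ifs <;> simp

theorem bracket_V_V_neg {x y : Lattice} (hx : form x x = 2) (hy : form y y = 2)
    (h : form x y = -2) : ⁅V x, V y⁆ = -H x := by
  rw [V, dif_pos hx, V, dif_pos hy, bracket_X_X, rootBracket,
    if_pos ((add_eq_zero_iff_form hx hy).2 h)]

theorem bracket_V_V_zero {x y : Lattice} (hx : form x x = 2) (hy : form y y = 2)
    (h : 0 ≤ form x y) : ⁅V x, V y⁆ = 0 := by
  rw [bracket_V_V hx hy (by omega), V_eq_zero, smul_zero]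
  rw [Ne, add_root_iff_form hx hy]
  omega

theorem bracket_swap (x y : IntegralForm) : ⁅x, y⁆ = -⁅y, x⁆ := by
  induction x using induction generalizing y with
  | hadd a b ha hb => rw [add_bracket, bracket_add, ha, hb]; abel
  | hneg a ha => rw [neg_bracket, bracket_neg, ha]
  | hH a =>
    induction y using induction with
    | hadd b c hb hc => rw [add_bracket, bracket_add, hb, hc]; abel
    | hneg b hb => rw [neg_bracket, bracket_neg, hb]
    | hH b => rw [bracket_H_H, bracket_H_H, neg_zero]
    | hX β => rw [bracket_H_X, bracket_X_H, neg_neg]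
  | hX α =>
    induction y using induction with
    | hadd b c hb hc => rw [add_bracket, bracket_add, hb, hc]; abel
    | hneg b hb => rw [neg_bracket, bracket_neg, hb]
    | hH b => rw [bracket_H_X, bracket_X_H]
    | hX β =>
      obtain ⟨x, hx⟩ := α
      obtain ⟨y, hy⟩ := β
      rw [X_eq_V, X_eq_V]
      change ⁅V x, V y⁆ = -⁅V y, V x⁆
      have h := neg_two_le_form hx hy
      rcases (by omega : form x y = -2 ∨ form x y = -1 ∨ 0 ≤ form x y) with h | h | h
      · have h' : form y x = -2 := by rwa [form_comm]
        rw [bracket_V_V_neg hx hy h, bracket_V_V_neg hy hx h',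
          ← neg_eq_of_add_eq_zero_right ((add_eq_zero_iff_form hx hy).2 h), H_neg, neg_neg]
      · have h' : form y x = -1 := by rwa [form_comm]
        rw [bracket_V_V hx hy (by omega), bracket_V_V hy hx (by omega), sign_swap_odd h,
          add_comm y x, neg_smul, neg_neg]
      · have h' : 0 ≤ form y x := by rwa [form_comm]
        rw [bracket_V_V_zero hx hy h, bracket_V_V_zero hy hx h', neg_zero]

theorem bracket_self (x : IntegralForm) : ⁅x, x⁆ = 0 := by
  have h : ⁅x, x⁆ + ⁅x, x⁆ = 0 := eq_neg_iff_add_eq_zero.1 (bracket_swap x x)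
  generalize ⁅x, x⁆ = y at h
  have h' : (2 : ℤ) • (show Lattice × (Root →₀ ℤ) from y) = 0 := by
    rw [two_smul]; exact h
  exact (smul_eq_zero.1 h').resolve_left two_ne_zero

/-- The Jacobiator. -/
noncomputable def jac (x y z : IntegralForm) : IntegralForm :=
  ⁅x, ⁅y, z⁆⁆ + ⁅y, ⁅z, x⁆⁆ + ⁅z, ⁅x, y⁆⁆

theorem jac_rot (x y z : IntegralForm) : jac x y z = jac y z x := by
  rw [jac, jac]; abel

theorem jac_swap (x y z : IntegralForm) : jac x y z = -jac y x z := by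
  rw [jac, jac, bracket_swap y z, bracket_swap z x, bracket_swap x y]
  simp only [bracket_neg]
  abel

theorem jac_add (x x' y z : IntegralForm) : jac (x + x') y z = jac x y z + jac x' y z := by
  simp only [jac, add_bracket, bracket_add]; abel

theorem jac_neg (x y z : IntegralForm) : jac (-x) y z = -jac x y z := by
  simp only [jac, neg_bracket, bracket_neg]; abel

theorem jac_H_H_X (x y : Lattice) (γ : Root) : jac (H x) (H y) (X γ) = 0 := by
  simp only [jac, bracket_H_X, bracket_X_H, bracket_H_H, bracket_zsmul, bracket_zero,
    bracket_neg, smul_smul, mul_comm (form x γ.1)]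
  abel

theorem jac_H_V_V (x : Lattice) {y z : Lattice} (hy : form y y = 2) (hz : form z z = 2) :
    jac (H x) (V y) (V z) = 0 := by
  rw [jac]
  by_cases h : form y z = -2
  · have h' : form z y = -2 := by rwa [form_comm]
    have e := neg_eq_of_add_eq_zero_right ((add_eq_zero_iff_form hy hz).2 h)
    simp only [bracket_H_V, bracket_V_H, bracket_zsmul, bracket_neg, bracket_H_H,
      bracket_V_V_neg hy hz h, bracket_V_V_neg hz hy h']
    simp [← e, form_neg_right, H_neg]
  · have h' : form z y ≠ -2 := by rwa [form_comm]
    have h3 : sign z y • V (z + y) = -(sign y z • V (y + z)) := by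
      rw [← bracket_V_V hz hy h', ← bracket_V_V hy hz h, bracket_swap]
    simp only [bracket_H_V, bracket_V_H, bracket_zsmul, bracket_neg,
      bracket_V_V hy hz h, bracket_V_V hz hy h', h3]
    rw [form_add_right, smul_neg, smul_smul, smul_smul, smul_smul, ← neg_smul, ← neg_smul,
      ← add_smul, ← add_smul]
    convert zero_smul ℤ _ using 2
    ring

/-- Two of the three roots are opposite. -/
theorem jac_neg_right {x y z : Lattice} (hx : form x x = 2) (hy : form y y = 2)
    (hz : form z z = 2) (h : form y z = -2) : jac (V x) (V y) (V z) = 0 := by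
  have e := neg_eq_of_add_eq_zero_right ((add_eq_zero_iff_form hy hz).2 h)
  subst e
  have hyx : form y x = form x y := form_comm y x
  have l1 := neg_two_le_form hx hy
  have l2 := neg_two_le_form hx hz
  rw [form_neg_right] at l2
  rw [jac, bracket_V_V_neg hy hz h, bracket_neg, bracket_V_H, neg_neg, hyx]
  rcases (by omega : form x y = -2 ∨ form x y = -1 ∨ form x y = 0 ∨ form x y = 1 ∨ form x y = 2)
    with c | c | c | c | c
  · have e := neg_eq_of_add_eq_zero_right ((add_eq_zero_iff_form hx hy).2 c)
    rw [bracket_V_V_zero hz hx (by rw [form_neg_left]; omega), bracket_V_V_neg hx hy c,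
      bracket_neg, bracket_V_H, bracket_zero, c, ← e, neg_neg, neg_neg, hx]
    module
  · rw [bracket_V_V_zero hz hx (by rw [form_neg_left]; omega), bracket_V_V hx hy (by omega),
      bracket_zero, bracket_zsmul,
      bracket_V_V hz ((add_root_iff_form hx hy).2 c)
        (by rw [form_neg_left, form_add_right, hy, hyx, c]; decide),
      smul_smul, c, sign_neg_left, sign_add_right, sign_self hy, sign_swap_odd c,
      show -y + (x + y) = x by abel,
      show sign x y * (-sign x y * -1) = sign x y * sign x y by ring, sign_mul_self]
    module
  · rw [bracket_V_V_zero hz hx (by rw [form_neg_left]; omega),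
      bracket_V_V_zero hx hy (by omega), bracket_zero, bracket_zero, c]
    module
  · have c' : form y (-x) = -1 := by rw [form_neg_right, hyx, c]
    have s := sign_swap_odd c'
    rw [sign_neg_left, sign_neg_right] at s
    rw [bracket_V_V_zero hx hy (by omega), bracket_V_V hz hx (by rw [form_neg_left]; omega),
      bracket_zero, bracket_zsmul,
      bracket_V_V hy ((add_root_iff_form hz hx).2 (by rw [form_neg_left]; omega))
        (by rw [form_add_right, form_neg_right, hy, hyx, c]; decide),
      smul_smul, c, sign_neg_left, sign_add_right, sign_neg_right, sign_self hy,
      show y + (-y + x) = x by abel,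
      show sign y x * (-1 * sign y x) = -(sign y x * sign y x) by ring, sign_mul_self]
    module
  · have e := eq_zero_of_form_self (x + -y)
      (by rw [form_add_self, form_neg_right, form_neg_right, form_neg_left]; omega)
    have e' : x = y := by rwa [← sub_eq_add_neg, sub_eq_zero] at e
    rw [bracket_V_V_zero hx hy (by omega),
      bracket_V_V_neg hz hx (by rw [form_neg_left]; omega),
      bracket_zero, bracket_neg, bracket_V_H, form_neg_left, hy, c, e']
    module

/-- The sum of the three roots is a root and two of them are orthogonal. -/
theorem jac_root {x y z : Lattice} (hx : form x x = 2) (hy : form y y = 2)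
    (hz : form z z = 2) (hxy : form x y = -1) (hxz : form x z = -1) (hyz : form y z = 0) :
    jac (V x) (V y) (V z) = 0 := by
  have hzx : form z x = -1 := by rwa [form_comm]
  have hyx : form y x = -1 := by rwa [form_comm]
  have hzy : form z y = 0 := by rwa [form_comm]
  rw [jac, bracket_V_V_zero hy hz hyz.ge, bracket_zero, bracket_V_V hz hx (by omega),
    bracket_V_V hx hy (by omega), bracket_zsmul, bracket_zsmul,
    bracket_V_V hy ((add_root_iff_form hz hx).2 hzx) (by rw [form_add_right]; omega),
    bracket_V_V hz ((add_root_iff_form hx hy).2 hxy) (by rw [form_add_right]; omega),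
    smul_smul, smul_smul, sign_add_right, sign_add_right, sign_swap_odd hxy,
    sign_swap_odd hxz, sign_swap_even hyz, show y + (z + x) = z + (x + y) by abel,
    zero_add, ← add_smul]
  convert zero_smul ℤ _ using 2
  ring

/-- The sum of the three roots is zero. -/
theorem jac_zero {x y z : Lattice} (hx : form x x = 2) (hy : form y y = 2)
    (hz : form z z = 2) (hxy : form x y = -1) (hxz : form x z = -1) (hyz : form y z = -1) :
    jac (V x) (V y) (V z) = 0 := by
  have hzx : form z x = -1 := by rwa [form_comm]
  have hyx : form y x = -1 := by rwa [form_comm]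
  have hzy : form z y = -1 := by rwa [form_comm]
  have e : z = -(x + y) := by
    refine (neg_eq_of_add_eq_zero_right (eq_zero_of_form_self _ ?_)).symm
    rw [form_add_self, form_add_self, form_add_left]; omega
  rw [jac, bracket_V_V hy hz (by omega), bracket_V_V hz hx (by omega),
    bracket_V_V hx hy (by omega), bracket_zsmul, bracket_zsmul, bracket_zsmul,
    bracket_V_V_neg hx ((add_root_iff_form hy hz).2 hyz) (by rw [form_add_right]; omega),
    bracket_V_V_neg hy ((add_root_iff_form hz hx).2 hzx) (by rw [form_add_right]; omega),
    bracket_V_V_neg hz ((add_root_iff_form hx hy).2 hxy) (by rw [form_add_right]; omega),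
    e, sign_neg_right, sign_neg_left, sign_add_right, sign_add_left, sign_self hx, sign_self hy,
    sign_swap_odd hxy, H_neg, H_add]
  module

theorem jac_V_V_V {x y z : Lattice} (hx : form x x = 2) (hy : form y y = 2)
    (hz : form z z = 2) : jac (V x) (V y) (V z) = 0 := by
  have hzx : form z x = form x z := form_comm z x
  have hyx : form y x = form x y := form_comm y x
  have hzy : form z y = form y z := form_comm z y
  have lxy := neg_two_le_form hx hy
  have lxz := neg_two_le_form hx hz
  have lyz := neg_two_le_form hy hz
  by_cases c1 : form y z = -2
  · exact jac_neg_right hx hy hz c1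
  by_cases c2 : form x z = -2
  · rw [jac_rot]; exact jac_neg_right hy hz hx (by omega)
  by_cases c3 : form x y = -2
  · rw [jac_rot, jac_rot]; exact jac_neg_right hz hx hy c3
  -- the inner brackets are multiples of root vectors
  have key {u v w : Lattice} (hu : form u u = 2) (hv : form v v = 2) (hw : form w w = 2)
      (huv : form u v ≠ -2) (huw : form u w ≠ -2) (hvw : form v w ≠ -2)
      (h : form v w ≠ -1 ∨ 0 ≤ form u v + form u w) : ⁅V u, ⁅V v, V w⁆⁆ = 0 := by
    rw [bracket_V_V hv hw hvw, bracket_zsmul]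
    by_cases g : form v w = -1
    · rw [bracket_V_V_zero hu ((add_root_iff_form hv hw).2 g)
        (by rw [form_add_right]; exact h.resolve_left (not_not.2 g)), smul_zero]
    · rw [V_eq_zero (fun k => g ((add_root_iff_form hv hw).1 k)), bracket_zero, smul_zero]
  by_cases d : form x y + form x z + form y z = -3
  · exact jac_zero hx hy hz (by omega) (by omega) (by omega)
  by_cases d1 : form x y = -1 ∧ form x z = -1
  · rcases (by omega : form y z = 0 ∨ 1 ≤ form y z) with g | g
    · exact jac_root hx hy hz d1.1 d1.2 g
    · rw [jac, key hx hy hz, key hy hz hx, key hz hx hy] <;> first | omega | simp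
  by_cases d2 : form x y = -1 ∧ form y z = -1
  · rcases (by omega : form x z = 0 ∨ 1 ≤ form x z) with g | g
    · rw [jac_rot]; exact jac_root hy hz hx d2.2 (by omega) (by omega)
    · rw [jac, key hx hy hz, key hy hz hx, key hz hx hy] <;> first | omega | simp
  by_cases d3 : form x z = -1 ∧ form y z = -1
  · rcases (by omega : form x y = 0 ∨ 1 ≤ form x y) with g | g
    · rw [jac_rot, jac_rot]; exact jac_root hz hx hy (by omega) (by omega) g
    · rw [jac, key hx hy hz, key hy hz hx, key hz hx hy] <;> first | omega | simp
  rw [jac, key hx hy hz, key hy hz hx, key hz hx hy] <;> first | omega | simp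

theorem jac_eq_zero (x y z : IntegralForm) : jac x y z = 0 := by
  induction x using induction generalizing y z with
  | hadd a b ha hb => rw [jac_add, ha, hb, add_zero]
  | hneg a ha => rw [jac_neg, ha, neg_zero]
  | hH a =>
    rw [jac_rot]
    induction y using induction generalizing z with
    | hadd a b ha hb => rw [jac_add, ha, hb, add_zero]
    | hneg a ha => rw [jac_neg, ha, neg_zero]
    | hH b =>
      rw [jac_rot]
      induction z using induction with
      | hadd a b ha hb => rw [jac_add, ha, hb, add_zero]
      | hneg a ha => rw [jac_neg, ha, neg_zero]
      | hH c => simp only [jac, bracket_H_H, bracket_zero, add_zero]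
      | hX γ => rw [jac_rot, jac_H_H_X]
    | hX β =>
      rw [jac_rot]
      induction z using induction with
      | hadd a b ha hb => rw [jac_add, ha, hb, add_zero]
      | hneg a ha => rw [jac_neg, ha, neg_zero]
      | hH c => rw [jac_H_H_X]
      | hX γ => rw [jac_rot, X_eq_V, X_eq_V, jac_H_V_V a β.2 γ.2]
  | hX α =>
    rw [jac_rot]
    induction y using induction generalizing z with
    | hadd a b ha hb => rw [jac_add, ha, hb, add_zero]
    | hneg a ha => rw [jac_neg, ha, neg_zero]
    | hH b =>
      rw [jac_rot]
      induction z using induction with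
      | hadd a b ha hb => rw [jac_add, ha, hb, add_zero]
      | hneg a ha => rw [jac_neg, ha, neg_zero]
      | hH c => rw [jac_rot, jac_rot, jac_H_H_X]
      | hX γ => rw [jac_rot, jac_rot, X_eq_V, X_eq_V, jac_H_V_V b γ.2 α.2]
    | hX β =>
      rw [jac_rot]
      induction z using induction with
      | hadd a b ha hb => rw [jac_add, ha, hb, add_zero]
      | hneg a ha => rw [jac_neg, ha, neg_zero]
      | hH c => rw [X_eq_V, X_eq_V, jac_H_V_V c α.2 β.2]
      | hX γ => rw [X_eq_V, X_eq_V, X_eq_V, jac_V_V_V γ.2 α.2 β.2]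

noncomputable instance : LieRing IntegralForm where
  add_lie := add_bracket
  lie_add := bracket_add
  lie_self := bracket_self
  leibniz_lie x y z := by
    have h := jac_eq_zero x y z
    rw [jac, bracket_swap z x, bracket_neg, bracket_swap z ⁅x, y⁆, add_assoc, add_eq_zero_iff_eq_neg] at h
    rw [h]; abel

open scoped Classical in
/-- The root vector `e_α` of the Chevalley basis; together with the elements
`h_i = H (Pi.single i 1)` these form a `ℤ`-basis. -/
noncomputable def e (α : Root) : IntegralForm :=
  if 0 ≤ α.1 then X α else -X α

/-- The relations of a Chevalley basis of type `E₈`. -/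
theorem chevalley_relations :
    (∀ x y : Lattice, ⁅H x, H y⁆ = 0) ∧
    (∀ (x : Lattice) (β : Root), ⁅H x, e β⁆ = form x β.1 • e β) ∧
    (∀ α : Root, ⁅e α, e (-α)⁆ = H α.1) ∧
    (∀ α β γ : Root, γ.1 = α.1 + β.1 → ⁅e α, e β⁆ = e γ ∨ ⁅e α, e β⁆ = -e γ) ∧
    (∀ α β : Root, α.1 + β.1 ≠ 0 → form (α.1 + β.1) (α.1 + β.1) ≠ 2 → ⁅e α, e β⁆ = 0) := by
  have he (α : Root) : e α = X α ∨ e α = -X α := by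
    unfold e; split_ifs <;> simp
  have hs (x y : Lattice) : sign x y = 1 ∨ sign x y = -1 :=
    mul_self_eq_one_iff.1 (sign_mul_self x y)
  refine ⟨bracket_H_H, fun x β => ?_, fun α => ?_, fun α β γ h => ?_, fun α β h h' => ?_⟩
  · rcases he β with h | h <;> rw [h] <;> simp [bracket_H_X]
  · obtain ⟨x, hx⟩ := α
    have hb : ⁅X ⟨x, hx⟩, X (-⟨x, hx⟩)⁆ = -H x := by
      rw [bracket_X_X, rootBracket,
        if_pos (show x + (-(⟨x, hx⟩ : Root)).1 = 0 from add_neg_cancel x)]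
    have hne : x ≠ 0 := by rintro rfl; simp [form_zero_right] at hx
    by_cases h : 0 ≤ x
    · have h' : ¬ 0 ≤ -x := fun k => hne (le_antisymm (neg_nonneg.1 k) h)
      rw [e, e, if_pos h, if_neg (show ¬ 0 ≤ (-(⟨x, hx⟩ : Root)).1 from h'), bracket_neg, hb, neg_neg]
    · rw [e, e, if_neg h,
        if_pos (show 0 ≤ (-(⟨x, hx⟩ : Root)).1 from (nonneg_or_nonpos hx).resolve_left h),
        neg_bracket, hb, neg_neg]
  · have h0 : α.1 + β.1 ≠ 0 := by
      rw [← h]; intro k; have := γ.2; simp [k, form_zero_right] at this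
    have h2 : form (α.1 + β.1) (α.1 + β.1) = 2 := h ▸ γ.2
    have hb : ⁅X α, X β⁆ = sign α.1 β.1 • X γ := by
      rw [bracket_X_X, rootBracket, if_neg h0, dif_pos h2]
      congr 2
      exact Subtype.ext h.symm
    rcases he α with a | a <;> rcases he β with b | b <;> rcases he γ with c | c <;>
      rcases hs α.1 β.1 with d | d <;>
      simp [a, b, c, hb, d, neg_bracket, bracket_neg]
  · have hb : ⁅X α, X β⁆ = 0 := by
      rw [bracket_X_X, rootBracket, if_neg h, dif_neg h']
    rcases he α with a | a <;> rcases he β with b | b <;>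
      simp [a, b, hb, neg_bracket, bracket_neg]

end IntegralForm

/-- The Lie algebra of an algebraic group of type `E₈` over `k`: the Chevalley `ℤ`-form
tensored with `k`. -/
abbrev LieAlg (k : Type*) [Field k] : Type _ := k ⊗[ℤ] IntegralForm

/-- The root vector `e_α`. -/
noncomputable def e (k : Type*) [Field k] (α : Root) : LieAlg k := 1 ⊗ₜ[ℤ] IntegralForm.e α

/-- The root vector `f_α = e_{-α}`. -/
noncomputable def f (k : Type*) [Field k] (α : Root) : LieAlg k := e k (-α)

/-- The standard representative of the nilpotent orbit `E₈(a₂)`. -/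
noncomputable def e₁ (k : Type*) [Field k] : LieAlg k :=
  e k (root ![1, 0, 0, 0, 0, 0, 0, 0])
    + e k (root ![0, 1, 0, 0, 0, 0, 0, 0])
    + e k (root ![0, 0, 1, 0, 0, 0, 0, 0])
    + e k (root ![0, 1, 0, 1, 0, 0, 0, 0])
    + e k (root ![0, 0, 0, 1, 1, 0, 0, 0])
    + e k (root ![0, 0, 0, 0, 1, 1, 0, 0])
    + e k (root ![0, 0, 0, 0, 0, 1, 1, 0])
    + e k (root ![0, 0, 0, 0, 0, 0, 0, 1])

/-- The partner of `e₁`. -/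
noncomputable def f₁ (k : Type*) [Field k] : LieAlg k :=
  f k (root ![1, 1, 2, 2, 2, 1, 1, 0])
    + f k (root ![1, 1, 1, 2, 2, 1, 1, 1])
    + f k (root ![1, 1, 2, 3, 2, 1, 1, 0])
    + f k (root ![1, 1, 2, 2, 2, 2, 1, 0])
    + f k (root ![1, 1, 2, 2, 1, 1, 1, 1])
    + f k (root ![1, 2, 2, 3, 2, 1, 0, 0])
    + f k (root ![0, 1, 1, 2, 2, 2, 2, 1])

/-- The standard representative of the nilpotent orbit `E₈(a₄)`. -/
noncomputable def e₂ (k : Type*) [Field k] : LieAlg k :=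
  e k (root ![1, 0, 1, 0, 0, 0, 0, 0])
    + e k (root ![0, 1, 0, 1, 0, 0, 0, 0])
    + e k (root ![0, 0, 1, 1, 0, 0, 0, 0])
    + e k (root ![0, 0, 0, 1, 1, 0, 0, 0])
    + e k (root ![0, 0, 0, 0, 1, 1, 0, 0])
    + e k (root ![0, 0, 0, 0, 0, 1, 1, 0])
    + e k (root ![0, 0, 0, 0, 0, 0, 1, 1])
    + e k (root ![0, 0, 1, 1, 1, 0, 0, 0])

/-- The partner of `e₂`. -/
noncomputable def f₂ (k : Type*) [Field k] : LieAlg k :=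
  f k (root ![1, 1, 2, 3, 2, 2, 1, 1])
    + f k (root ![2, 2, 3, 4, 3, 2, 2, 1])
    + f k (root ![1, 2, 3, 4, 3, 3, 2, 1])
    + f k (root ![1, 2, 2, 4, 4, 3, 2, 1])

/-- The subalgebra generated by `e₁` and `f₁`. -/
noncomputable def L₁ (k : Type*) [Field k] : LieSubalgebra k (LieAlg k) :=
  LieSubalgebra.lieSpan k (LieAlg k) {e₁ k, f₁ k}

/-- The subalgebra generated by `e₂` and `f₂`. -/
noncomputable def L₂ (k : Type*) [Field k] : LieSubalgebra k (LieAlg k) :=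
  LieSubalgebra.lieSpan k (LieAlg k) {e₂ k, f₂ k}

end E8

namespace E8

/-! The argument combines the invariant form of `E₈` with a criterion of MeatAxe type. Write `v` for
the lowest and `z` for the highest root vector, and call a subspace stable if `ad e` and `ad f`
preserve it. The subalgebra `L` generated by `e` and `f` is the smallest stable subspace containing
them, so it can be found by applying `ad e` and `ad f` only.

The form is nondegenerate in characteristic 2 because the `E₈` lattice is unimodular, and `ad e`,
`ad f` are skew for it. No element of `L` involves `z`, so `v` is orthogonal to `L`. Since `v`
generates `L` as a stable subspace and `Lᗮ` is stable, `L ≤ Lᗮ`; as `dim L = 124 = 248 / 2`, this is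
an equality. Thus `g / L` is dual to `L`.

Now let `U` be stable with `L ≤ U`, so that `Uᗮ ≤ L`. A word `w` in `ad e`, `ad f` maps `L` into the
line of `v`. If `w` does not vanish on `Uᗮ`, then `v` lies in `Uᗮ`, hence `L ≤ Uᗮ` and `U = L`. If
it does vanish there, skewness puts the reversed word applied to `z` into `Uᗮᗮ = U`; this vector and
`L` together generate `g`, so `U = ⊤`. This is `stable_eq_or_eq_top`, and
`isCoatom_and_isIrreducible` turns it into maximality and irreducibility.

What remains is finite linear algebra. In characteristic 2 all structure constants reduce to 0 or 1,
so the operators are matrices over the prime field and vectors can be stored as bits of natural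
numbers. The kernel evaluates `check`, and `lieSpan_of_check` transfers the result to `k`: it uses
only spanning and membership statements, which survive extension of scalars. -/

/-- A subspace is stable if it is mapped into itself by `ad e` and `ad f`. -/
def Stable {k g : Type*} [Field k] [LieRing g] [LieAlgebra k g] (e f : g)
    (U : Submodule k g) : Prop :=
  ∀ x ∈ U, ⁅e, x⁆ ∈ U ∧ ⁅f, x⁆ ∈ U

/-! ### Stable subspaces and the duality criterion -/

section Abstract

variable {k g : Type*} [Field k] [LieRing g] [LieAlgebra k g] {e f : g}

/-- The elements of the Lie algebra that normalise a subspace. -/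
def stabilizer (U : Submodule k g) : LieSubalgebra k g where
  carrier := {x | ∀ u ∈ U, ⁅x, u⁆ ∈ U}
  add_mem' hx hy u hu := by rw [add_lie]; exact U.add_mem (hx u hu) (hy u hu)
  zero_mem' u _ := by rw [zero_lie]; exact U.zero_mem
  smul_mem' c x hx u hu := by rw [smul_lie]; exact U.smul_mem c (hx u hu)
  lie_mem' {x y} hx hy u hu := by
    rw [lie_lie]; exact U.sub_mem (hx _ (hy u hu)) (hy _ (hx u hu))

theorem Stable.lie_mem {U : Submodule k g} (hU : Stable e f U) {x : g}
    (hx : x ∈ LieSubalgebra.lieSpan k g {e, f}) {u : g} (hu : u ∈ U) : ⁅x, u⁆ ∈ U := by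
  have h : LieSubalgebra.lieSpan k g {e, f} ≤ stabilizer U := by
    rw [LieSubalgebra.lieSpan_le]
    rintro y (rfl | rfl)
    · exact fun u hu => (hU u hu).1
    · exact fun u hu => (hU u hu).2
  exact h hx u hu

/-- The elements of `U` that also normalise `U` form a subalgebra, and it contains both generators.
Hence closure under `ad e` and `ad f` suffices; no brackets of two general elements need to be
computed. -/
theorem Stable.lieSpan_le {U : Submodule k g} (hU : Stable e f U) (he : e ∈ U) (hf : f ∈ U) :
    (LieSubalgebra.lieSpan k g {e, f}).toSubmodule ≤ U := by
  intro x hx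
  let K : LieSubalgebra k g :=
    { U ⊓ (stabilizer U).toSubmodule with
      lie_mem' := fun {x y} hx hy => ⟨hx.2 y hy.1, (stabilizer U).lie_mem hx.2 hy.2⟩ }
  have h : LieSubalgebra.lieSpan k g {e, f} ≤ K := by
    rw [LieSubalgebra.lieSpan_le]
    rintro y (rfl | rfl)
    · exact ⟨he, fun u hu => (hU u hu).1⟩
    · exact ⟨hf, fun u hu => (hU u hu).2⟩
  exact (h hx).1

theorem stable_lieSpan : Stable e f (LieSubalgebra.lieSpan k g {e, f}).toSubmodule :=
  fun _ hx =>
    ⟨LieSubalgebra.lie_mem _ (LieSubalgebra.subset_lieSpan (by simp)) hx,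
      LieSubalgebra.lie_mem _ (LieSubalgebra.subset_lieSpan (by simp)) hx⟩

variable (k e f) in
/-- The composite of `ad e` (for `true`) and `ad f` (for `false`) along a word. -/
def adWord (w : List Bool) : Module.End k g :=
  w.foldr (fun c φ => LieAlgebra.ad k g (cond c e f) ∘ₗ φ) LinearMap.id

theorem Stable.adWord_mem {U : Submodule k g} (hU : Stable e f U) (w : List Bool) {x : g}
    (hx : x ∈ U) : adWord k e f w x ∈ U := by
  induction w with
  | nil => exact hx
  | cons c w ih => cases c <;> [exact (hU _ ih).2; exact (hU _ ih).1]

theorem adWord_append (w w' : List Bool) (x : g) :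
    adWord k e f (w ++ w') x = adWord k e f w (adWord k e f w' x) := by
  induction w with
  | nil => rfl
  | cons c w ih => exact congrArg (⁅cond c e f, ·⁆) ih

/-- `ad e` and `ad f` are skew for the form. -/
def Skew (B : LinearMap.BilinForm k g) (e f : g) : Prop :=
  ∀ x y, B ⁅e, x⁆ y = -B x ⁅e, y⁆ ∧ B ⁅f, x⁆ y = -B x ⁅f, y⁆

/-- Moving letters across the form one at a time reverses their order. Each move costs a sign, which
does not matter for vanishing. -/
theorem Skew.adWord_eq_zero {B : LinearMap.BilinForm k g} (hB : Skew B e f) (w : List Bool)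
    {x y : g} (h : B x (adWord k e f w y) = 0) : B (adWord k e f w.reverse x) y = 0 := by
  induction w generalizing x with
  | nil => exact h
  | cons c w ih =>
    rw [List.reverse_cons, adWord_append]
    apply ih
    cases c
    · change B ⁅f, x⁆ _ = 0
      rw [(hB _ _).2, neg_eq_zero]; exact h
    · change B ⁅e, x⁆ _ = 0
      rw [(hB _ _).1, neg_eq_zero]; exact h

theorem Skew.stable_orthogonal {B : LinearMap.BilinForm k g} (hB : Skew B e f)
    {U : Submodule k g} (hU : Stable e f U) : Stable e f (B.orthogonal U) := by
  intro x hx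
  rw [LinearMap.BilinForm.mem_orthogonal_iff] at hx
  simp only [LinearMap.BilinForm.mem_orthogonal_iff] at hx ⊢
  exact ⟨fun n hn => neg_eq_zero.1 (by rw [← (hB n x).1, hx _ (hU n hn).1]),
    fun n hn => neg_eq_zero.1 (by rw [← (hB n x).2, hx _ (hU n hn).2])⟩

/-- A form of Norton's irreducibility criterion: the rank-one word is tested on `Uᗮ`, and
self-orthogonality of `L` replaces a separate test on the dual module. -/
theorem stable_eq_or_eq_top [FiniteDimensional k g] {B : LinearMap.BilinForm k g} (hB : Skew B e f)
    (hn : B.Nondegenerate) (hs : B.IsSymm) {L : Submodule k g}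
    (hLL : B.orthogonal L = L) {v z : g} {w : List Bool}
    (hrank : ∀ l ∈ L, adWord k e f w l ∈ k ∙ v)
    (hv : ∀ U : Submodule k g, Stable e f U → v ∈ U → L ≤ U)
    (hz : ∀ U : Submodule k g, Stable e f U → L ≤ U → adWord k e f w.reverse z ∈ U → U = ⊤)
    {U : Submodule k g} (hU : Stable e f U) (hLU : L ≤ U) : U = L ∨ U = ⊤ := by
  have hr : B.IsRefl := hs.isRefl
  have hI := hB.stable_orthogonal hU
  have hIL : B.orthogonal U ≤ L := hLL ▸ LinearMap.BilinForm.orthogonal_le hLU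
  have hUU : B.orthogonal (B.orthogonal U) = U :=
    LinearMap.BilinForm.orthogonal_orthogonal hn hr U
  -- Either the word kills `Uᗮ`, and its reverse sends `z` into `Uᗮᗮ = U`, or it produces a nonzero
  -- multiple of `v` inside `Uᗮ`.
  by_cases h : ∀ l ∈ B.orthogonal U, adWord k e f w l = 0
  · right
    refine hz U hU hLU ?_
    rw [← hUU, LinearMap.BilinForm.mem_orthogonal_iff]
    intro l hl
    refine hr _ _ (hB.adWord_eq_zero w ?_)
    rw [h l hl, map_zero]
  · left
    push Not at h
    obtain ⟨l, hl, hne⟩ := h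
    obtain ⟨c, hc⟩ := Submodule.mem_span_singleton.1 (hrank l (hIL hl))
    have hc0 : c ≠ 0 := by rintro rfl; exact hne (by rw [← hc, zero_smul])
    have hvI : v ∈ B.orthogonal U :=
      ((B.orthogonal U).smul_mem_iff hc0).1 (hc ▸ hI.adWord_mem w hl)
    refine le_antisymm ?_ hLU
    calc U = B.orthogonal (B.orthogonal U) := hUU.symm
      _ ≤ B.orthogonal L := LinearMap.BilinForm.orthogonal_le (hv _ hI hvI)
      _ = L := hLL

/-- Subalgebras above `L` are stable because they contain `e` and `f`; preimages of submodules of `g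
/ L` are stable because `e` and `f` lie in `L`. Both statements are thus cases of the hypothesis on
stable subspaces. -/
theorem isCoatom_and_isIrreducible {L : LieSubalgebra k g}
    (hL : L = LieSubalgebra.lieSpan k g {e, f}) (htop : L ≠ ⊤)
    (h : ∀ U : Submodule k g, Stable e f U → L.toSubmodule ≤ U → U = L.toSubmodule ∨ U = ⊤) :
    IsCoatom L ∧ LieModule.IsIrreducible k L (g ⧸ L.toLieSubmodule) := by
  have he : e ∈ L := hL ▸ LieSubalgebra.subset_lieSpan (by simp)
  have hf : f ∈ L := hL ▸ LieSubalgebra.subset_lieSpan (by simp)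
  refine ⟨⟨htop, fun K hK => ?_⟩, ?_⟩
  · rcases h K.toSubmodule (fun x hx => ⟨K.lie_mem (hK.le he) hx, K.lie_mem (hK.le hf) hx⟩)
      hK.le with h | h
    · exact absurd (LieSubalgebra.toSubmodule_injective h).symm hK.ne
    · exact LieSubalgebra.toSubmodule_injective h
  · have hnt : Nontrivial (g ⧸ L.toLieSubmodule) := by
      refine Submodule.Quotient.nontrivial_iff.2 fun h => htop ?_
      exact LieSubalgebra.toSubmodule_injective h
    refine LieModule.IsIrreducible.mk fun N hN => ?_
    let π := LieSubmodule.Quotient.mk' L.toLieSubmodule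
    have hst : Stable e f (N.comap π).toSubmodule := fun x hx =>
      ⟨(N.comap π).lie_mem (x := (⟨e, he⟩ : L)) hx, (N.comap π).lie_mem (x := (⟨f, hf⟩ : L)) hx⟩
    have hsurj : ∀ y, ∃ x, π x = y := LieSubmodule.Quotient.surjective_mk' _
    have hle : L.toSubmodule ≤ (N.comap π).toSubmodule := by
      intro x hx
      have : π x = 0 := (LieSubmodule.Quotient.mk_eq_zero _).2 hx
      change π x ∈ N
      rw [this]; exact N.zero_mem
    rcases h _ hst hle with h | h
    · refine absurd ?_ hN
      rw [eq_bot_iff]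
      intro y hy
      obtain ⟨x, rfl⟩ := hsurj y
      have : x ∈ L.toSubmodule := h ▸ (show x ∈ (N.comap π).toSubmodule from hy)
      exact (LieSubmodule.Quotient.mk_eq_zero _).2 this
    · rw [eq_top_iff]
      intro y _
      obtain ⟨x, rfl⟩ := hsurj y
      exact (h.ge (Submodule.mem_top : x ∈ ⊤) :)

end Abstract

/-! ### Enumeration of the 240 roots -/

/-- The positive roots, sorted by height; the decimal digits are the coefficients. -/
def positiveRoots : List ℕ :=
  [10000000, 1000000, 100000, 10000, 1000, 100, 10, 1, 10100000, 1010000, 110000, 11000, 1100,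
   110, 11, 10110000, 1110000, 1011000, 111000, 11100, 1110, 111, 11110000, 10111000, 1111000,
   1011100, 111100, 11110, 1111, 11111000, 10111100, 1121000, 1111100, 1011110, 111110, 11111,
   11121000, 11111100, 10111110, 1121100, 1111110, 1011111, 111111, 11221000, 11121100,
   11111110, 10111111, 1122100, 1121110, 1111111, 11221100, 11122100, 11121110, 11111111,
   1122110, 1121111, 11222100, 11221110, 11122110, 11121111, 1122210, 1122111, 11232100,
   11222110, 11221111, 11122210, 11122111, 1122211, 12232100, 11232110, 11222210, 11222111,
   11122211, 1122221, 12232110, 11232210, 11232111, 11222211, 11122221, 12232210, 12232111,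
   11233210, 11232211, 11222221, 12233210, 12232211, 11233211, 11232221, 12243210, 12233211,
   12232221, 11233221, 12343210, 12243211, 12233221, 11233321, 22343210, 12343211, 12243221,
   12233321, 22343211, 12343221, 12243321, 22343221, 12343321, 12244321, 22343321, 12344321,
   22344321, 12354321, 22354321, 13354321, 23354321, 22454321, 23454321, 23464321, 23465321,
   23465421, 23465431, 23465432]

/-- The positions in `positiveRoots` of the roots, by their residues modulo `2` (read as binary
numbers, lowest digit first); the entries for the other residues are arbitrary. -/
def residueTable : List ℕ :=
  [0, 0, 1, 0, 2, 8, 0, 0, 3, 0, 9, 0, 10, 15, 16, 22, 4, 0, 0, 43, 0, 0, 31, 36, 11, 0, 17, 0,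
   18, 23, 24, 29, 5, 0, 0, 56, 0, 0, 47, 51, 0, 68, 0, 62, 0, 0, 0, 0, 12, 0, 0, 50, 0, 0, 39,
   44, 19, 0, 25, 0, 26, 30, 32, 37, 6, 0, 0, 70, 0, 0, 60, 65, 0, 79, 0, 75, 0, 0, 0, 0, 0, 88,
   119, 0, 96, 92, 0, 0, 0, 84, 0, 81, 0, 0, 0, 0, 13, 0, 0, 63, 0, 0, 54, 58, 0, 74, 0, 69, 0,
   0, 0, 0, 20, 0, 0, 57, 0, 0, 48, 52, 27, 0, 33, 0, 34, 38, 40, 45, 7, 0, 0, 83, 0, 0, 73, 78,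
   0, 90, 0, 87, 0, 0, 0, 0, 0, 98, 117, 0, 103, 101, 0, 0, 0, 94, 0, 91, 0, 0, 0, 0, 0, 105,
   115, 0, 108, 107, 0, 0, 113, 0, 114, 0, 110, 109, 112, 111, 0, 102, 116, 0, 106, 104, 0, 0,
   0, 99, 0, 95, 0, 0, 0, 0, 14, 0, 0, 77, 0, 0, 67, 72, 0, 85, 0, 82, 0, 0, 0, 0, 0, 93, 118,
   0, 100, 97, 0, 0, 0, 89, 0, 86, 0, 0, 0, 0, 21, 0, 0, 71, 0, 0, 61, 66, 0, 80, 0, 76, 0, 0,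
   0, 0, 28, 0, 0, 64, 0, 0, 55, 59, 35, 0, 41, 0, 42, 46, 49, 53]

/-- The `i`-th vector of the list of all roots: first the positive roots, then their negatives. -/
def rootVec (i : ℕ) : Lattice := fun j =>
  if i < 120 then (positiveRoots.getD i 0 / 10 ^ (7 - j.val) % 10 : ℕ)
  else -(positiveRoots.getD (i - 120) 0 / 10 ^ (7 - j.val) % 10 : ℕ)

/-- The position of a root in the list of all roots. -/
def rootIdx (x : Lattice) : ℕ :=
  residueTable.getD ((x 0 % 2).toNat + 2 * (x 1 % 2).toNat + 4 * (x 2 % 2).toNat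
    + 8 * (x 3 % 2).toNat + 16 * (x 4 % 2).toNat + 32 * (x 5 % 2).toNat + 64 * (x 6 % 2).toNat
    + 128 * (x 7 % 2).toNat) 0
  + if 0 ≤ x 0 + x 1 + x 2 + x 3 + x 4 + x 5 + x 6 + x 7 then 0 else 120

/-- The simple roots. -/
def simple (s : Fin 8) : Lattice := Pi.single s 1

/-- The vector occurs at its position in the list of all roots. -/
def Listed (x : Lattice) : Prop := rootIdx x < 240 ∧ ∀ j, rootVec (rootIdx x) j = x j

instance (x : Lattice) : Decidable (Listed x) := inferInstanceAs (Decidable (_ ∧ _))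

/-- Two roots congruent modulo 2 are equal or opposite, so the residue together with the sign of the
height determines a root. This is why the lookup in `rootIdx` can succeed. -/
theorem rootIdx_rootVec : ∀ i < 240, rootIdx (rootVec i) = i := by decide +kernel

theorem form_rootVec : ∀ i < 240, form (rootVec i) (rootVec i) = 2 := by decide +kernel

theorem listed_simple : ∀ s, Listed (simple s) ∧ Listed (-simple s) := by decide +kernel

/-- The inductive step for completeness of the table: adding a simple root with product `-1` does
not leave the list. -/
theorem listed_add_simple : ∀ i < 240, ∀ s, form (rootVec i) (simple s) = -1 →
    Listed (rootVec i + simple s) ∧ Listed (-(rootVec i + simple s)) := by decide +kernel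

theorem Listed.rootVec_rootIdx {x : Lattice} (h : Listed x) : rootVec (rootIdx x) = x :=
  funext h.2

theorem form_eq_sum (x y : Lattice) : form x y = ∑ s, form x (simple s) * y s := by
  simp only [form, simple, Matrix.dotProduct_mulVec, dotProduct_single_one]
  rfl

theorem form_simple (s : Fin 8) : form (simple s) (simple s) = 2 := by decide +revert

/-- Induction on the height: a positive root that is not simple becomes a positive root of smaller
height after subtracting a suitable simple root. -/
theorem listed_of_nonneg (n : ℕ) : ∀ x : Lattice, form x x = 2 → 0 ≤ x → ∑ i, x i = n →
    Listed x ∧ Listed (-x) := by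
  induction n with
  | zero =>
    intro x hx h0 hn
    have : x = 0 := funext fun i =>
      (Finset.sum_eq_zero_iff_of_nonneg fun i _ => h0 i).1 (by simpa using hn) i (Finset.mem_univ i)
    simp [this, form_zero_right] at hx
  | succ n ih =>
    intro x hx h0 hn
    -- Otherwise expanding `form x x` along the nonnegative second argument would give a nonpositive
    -- number instead of 2.
    obtain ⟨s, hs⟩ : ∃ s, 0 < form x (simple s) := by
      by_contra! hc
      have := form_eq_sum x x ▸ Finset.sum_nonpos fun s _ =>
        mul_nonpos_of_nonpos_of_nonneg (hc s) (h0 s)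
      omega
    have hns : form (-simple s) (-simple s) = 2 := by
      rw [form_neg_left, form_neg_right, neg_neg, form_simple]
    have hle := neg_two_le_form hx hns
    rw [form_neg_right] at hle
    rcases (by omega : form x (simple s) = 2 ∨ form x (simple s) = 1) with h | h
    · have : x = simple s := by
        rw [← add_neg_eq_zero, add_eq_zero_iff_form hx hns, form_neg_right, h]
      exact this ▸ listed_simple s
    · have hr : form (x + -simple s) (x + -simple s) = 2 := by
        rw [add_root_iff_form hx hns, form_neg_right, h]
      have hsum : ∑ i, (x + -simple s) i = n := by
        simp [Finset.sum_add_distrib, hn, simple]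
      -- A negative root of height `n ≥ 0` would have all coefficients zero.
      have hnn : 0 ≤ x + -simple s := by
        refine (nonneg_or_nonpos hr).resolve_right fun hc => ?_
        have h1 : ∑ i, (-(x + -simple s)) i = 0 := by
          refine le_antisymm ?_ (Finset.sum_nonneg fun i _ => hc i)
          rw [Finset.sum_congr rfl fun i _ => Pi.neg_apply (x + -simple s) i,
            Finset.sum_neg_distrib, hsum]
          simp
        have : -(x + -simple s) = 0 := funext fun i =>
          (Finset.sum_eq_zero_iff_of_nonneg fun i _ => hc i).1 h1 i (Finset.mem_univ i)
        rw [neg_eq_zero] at this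
        simp [this, form_zero_right] at hr
      have hl := (ih _ hr hnn hsum).1
      have := listed_add_simple _ hl.1 s
      rw [hl.rootVec_rootIdx, form_add_left, form_neg_left, form_simple, h,
        neg_add_cancel_right] at this
      exact this rfl

theorem listed {x : Lattice} (hx : form x x = 2) : Listed x := by
  rcases nonneg_or_nonpos hx with h | h
  · exact (listed_of_nonneg (∑ i, x i).toNat x hx h
      (by rw [Int.toNat_of_nonneg (Finset.sum_nonneg fun i _ => h i)])).1
  · have := (listed_of_nonneg (∑ i, (-x) i).toNat (-x)
      (by rw [form_neg_left, form_neg_right, neg_neg, hx]) h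
      (by rw [Int.toNat_of_nonneg (Finset.sum_nonneg fun i _ => h i)])).2
    rwa [neg_neg] at this

/-- The enumeration of the roots. -/
def rootEquiv : Root ≃ Fin 240 where
  toFun α := ⟨rootIdx α.1, (listed α.2).1⟩
  invFun i := ⟨rootVec i, form_rootVec i i.2⟩
  left_inv α := Subtype.ext (listed α.2).rootVec_rootIdx
  right_inv i := Fin.ext (rootIdx_rootVec i i.2)

/-! ### The invariant form on the Chevalley lattice -/

namespace IntegralForm

/-- The invariant form, with `(h_α | h_β) = (α | β)` and `(X_α | X_{-α}) = -1`. -/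
noncomputable def pairing (x y : IntegralForm) : ℤ :=
  form x.1 y.1 - x.2.sum fun α a => a * y.2 (-α)

theorem pairing_add_left (x y z : IntegralForm) :
    pairing (x + y) z = pairing x z + pairing y z := by
  have h1 : (x + y).1 = x.1 + y.1 := rfl
  have h2 : (x + y).2 = x.2 + y.2 := rfl
  simp only [pairing, h1, h2]
  rw [Finsupp.sum_add_index' (by simp) (by intros; ring), form_add_left]
  ring

theorem pairing_add_right (x y z : IntegralForm) :
    pairing x (y + z) = pairing x y + pairing x z := by
  have h1 : (y + z).1 = y.1 + z.1 := rfl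
  have h2 : (y + z).2 = y.2 + z.2 := rfl
  simp only [pairing, h1, h2, Finsupp.add_apply, mul_add, Finsupp.sum_add, form_add_right]
  ring

/-- The invariant form as a bilinear form. -/
noncomputable def pairingForm : LinearMap.BilinForm ℤ IntegralForm :=
  (AddMonoidHom.mk' (fun x => (AddMonoidHom.mk' (pairing x) (pairing_add_right x)).toIntLinearMap)
    (fun x y => LinearMap.ext fun z => pairing_add_left x y z)).toIntLinearMap

theorem pairingForm_apply (x y : IntegralForm) : pairingForm x y = pairing x y := rfl

theorem pairing_neg_left (x y : IntegralForm) : pairing (-x) y = -pairing x y := by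
  simp only [← pairingForm_apply, map_neg, LinearMap.neg_apply]

theorem pairing_neg_right (x y : IntegralForm) : pairing x (-y) = -pairing x y := by
  simp only [← pairingForm_apply, map_neg]

theorem pairing_zsmul_left (n : ℤ) (x y : IntegralForm) : pairing (n • x) y = n * pairing x y := by
  simp only [← pairingForm_apply, map_zsmul, LinearMap.smul_apply, smul_eq_mul]

theorem pairing_zsmul_right (n : ℤ) (x y : IntegralForm) :
    pairing x (n • y) = n * pairing x y := by
  simp only [← pairingForm_apply, map_zsmul, smul_eq_mul]

theorem pairing_H_H (x y : Lattice) : pairing (H x) (H y) = form x y := by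
  simp [pairing, H_fst, H_snd]

theorem pairing_H_X (x : Lattice) (β : Root) : pairing (H x) (X β) = 0 := by
  simp [pairing, X_fst, H_snd, form_zero_right]

theorem pairing_X_H (α : Root) (y : Lattice) : pairing (X α) (H y) = 0 := by
  simp [pairing, X_fst, H_snd, form_comm 0, form_zero_right]

open scoped Classical in
theorem pairing_X_X (α β : Root) : pairing (X α) (X β) = if α.1 + β.1 = 0 then -1 else 0 := by
  have : β = -α ↔ α.1 + β.1 = 0 := by
    rw [Subtype.ext_iff, add_comm, add_eq_zero_iff_eq_neg]; rfl
  simp [pairing, X_fst, X_snd, form_zero_right, Finsupp.single_apply, this]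
  split_ifs <;> rfl

theorem pairing_comm (x y : IntegralForm) : pairing x y = pairing y x := by
  induction x using induction generalizing y with
  | hadd a b ha hb => rw [pairing_add_left, pairing_add_right, ha, hb]
  | hneg a ha => rw [pairing_neg_left, pairing_neg_right, ha]
  | hH a =>
    induction y using induction with
    | hadd b c hb hc => rw [pairing_add_left, pairing_add_right, hb, hc]
    | hneg b hb => rw [pairing_neg_left, pairing_neg_right, hb]
    | hH b => rw [pairing_H_H, pairing_H_H, form_comm]
    | hX β => rw [pairing_H_X, pairing_X_H]
  | hX α =>
    induction y using induction with
    | hadd b c hb hc => rw [pairing_add_left, pairing_add_right, hb, hc]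
    | hneg b hb => rw [pairing_neg_left, pairing_neg_right, hb]
    | hH b => rw [pairing_H_X, pairing_X_H]
    | hX β => rw [pairing_X_X, pairing_X_X, add_comm]

theorem pairing_H_V (x y : Lattice) : pairing (H x) (V y) = 0 := by
  by_cases h : form y y = 2
  · rw [V, dif_pos h, pairing_H_X]
  · rw [V_eq_zero h, ← pairingForm_apply, map_zero]

theorem pairing_V_V {x y : Lattice} (hx : form x x = 2) (h : x + y = 0) :
    pairing (V x) (V y) = -1 := by
  have hy : form y y = 2 := by
    rw [← neg_eq_of_add_eq_zero_right h, form_neg_left, form_neg_right, neg_neg, hx]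
  rw [V, dif_pos hx, V, dif_pos hy, pairing_X_X, if_pos h]

theorem pairing_V_V_zero {x y : Lattice} (h : x + y ≠ 0) : pairing (V x) (V y) = 0 := by
  by_cases hx : form x x = 2
  · by_cases hy : form y y = 2
    · rw [V, dif_pos hx, V, dif_pos hy, pairing_X_X, if_neg h]
    · rw [V_eq_zero hy, ← pairingForm_apply, map_zero]
  · rw [V_eq_zero hx, ← pairingForm_apply, map_zero, LinearMap.zero_apply]

theorem pairing_bracket_V_H_V {x y : Lattice} (a : Lattice) (hx : form x x = 2)
    (hy : form y y = 2) : pairing ⁅V x, H a⁆ (V y) = -pairing (H a) ⁅V x, V y⁆ := by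
  rw [bracket_V_H, pairing_neg_left, pairing_zsmul_left]
  by_cases h : form x y = -2
  · rw [pairing_V_V hx ((add_eq_zero_iff_form hx hy).2 h), bracket_V_V_neg hx hy h,
      pairing_neg_right, pairing_H_H]
    ring
  · rw [pairing_V_V_zero fun k => h ((add_eq_zero_iff_form hx hy).1 k), bracket_V_V hx hy h,
      pairing_zsmul_right, pairing_H_V]
    ring

/-- Only `x + y + z = 0` gives nonzero terms. There `ε(x, z) = ε(x, x) ε(x, y) = -ε(x, y)`, which is
the required skewness; in the remaining cases both sides vanish. -/
theorem pairing_bracket_V_V_V {x y z : Lattice} (hx : form x x = 2) (hy : form y y = 2)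
    (hz : form z z = 2) : pairing ⁅V x, V y⁆ (V z) = -pairing (V y) ⁅V x, V z⁆ := by
  have ne_zero {u : Lattice} (hu : form u u = 2) : u ≠ 0 := by
    rintro rfl; simp [form_zero_right] at hu
  by_cases h : form x y = -2
  · have e := (add_eq_zero_iff_form hx hy).2 h
    rw [bracket_V_V_neg hx hy h, pairing_neg_left, pairing_H_V]
    by_cases h' : form x z = -2
    · rw [bracket_V_V_neg hx hz h', pairing_neg_right, pairing_comm, pairing_H_V]; rfl
    · rw [bracket_V_V hx hz h', pairing_zsmul_right, pairing_V_V_zero]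
      · simp
      · rw [← add_assoc, add_comm y, e, zero_add]; exact ne_zero hz
  · by_cases h' : form x z = -2
    · have e := (add_eq_zero_iff_form hx hz).2 h'
      rw [bracket_V_V hx hy h, bracket_V_V_neg hx hz h', pairing_neg_right, pairing_comm (V y),
        pairing_H_V, pairing_zsmul_left, pairing_V_V_zero]
      · simp
      · rw [add_right_comm, e, zero_add]; exact ne_zero hy
    · rw [bracket_V_V hx hy h, bracket_V_V hx hz h', pairing_zsmul_left, pairing_zsmul_right]
      by_cases hs : x + y + z = 0
      · have e : z = -(x + y) := (neg_eq_of_add_eq_zero_right hs).symm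
        have hxy : form (x + y) (x + y) = 2 := by
          rw [e, form_neg_left, form_neg_right, neg_neg] at hz; exact hz
        rw [pairing_V_V hxy hs, pairing_V_V hy (by rw [← hs]; abel), e, sign_neg_right,
          sign_add_right, sign_self hx]
        ring
      · rw [pairing_V_V_zero hs, pairing_V_V_zero (fun k => hs (by rw [← k]; abel))]
        simp

theorem pairing_bracket_X (α : Root) (x y : IntegralForm) :
    pairing ⁅X α, x⁆ y = -pairing x ⁅X α, y⁆ := by
  rw [X_eq_V]
  induction x using induction generalizing y with
  | hadd a b ha hb => rw [bracket_add, pairing_add_left, pairing_add_left, ha, hb]; ring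
  | hneg a ha => rw [bracket_neg, pairing_neg_left, pairing_neg_left, ha]
  | hH a =>
    induction y using induction with
    | hadd b c hb hc => rw [bracket_add, pairing_add_right, pairing_add_right, hb, hc]; ring
    | hneg b hb => rw [bracket_neg, pairing_neg_right, pairing_neg_right, hb]
    | hH b =>
      simp only [bracket_V_H, pairing_neg_left, pairing_neg_right, pairing_zsmul_left,
        pairing_zsmul_right, pairing_H_V, pairing_comm (V _) (H _)]
      simp
    | hX β => rw [X_eq_V, pairing_bracket_V_H_V a α.2 β.2]
  | hX β =>
    rw [X_eq_V]
    induction y using induction with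
    | hadd b c hb hc => rw [bracket_add, pairing_add_right, pairing_add_right, hb, hc]; ring
    | hneg b hb => rw [bracket_neg, pairing_neg_right, pairing_neg_right, hb]
    | hH b =>
      rw [pairing_comm, pairing_comm (V β.1), pairing_bracket_V_H_V b α.2 β.2, neg_neg]
    | hX γ => rw [X_eq_V, pairing_bracket_V_V_V α.2 β.2 γ.2]

/-- The basis of the integral form given by the simple coroots and the vectors `X_α`. -/
noncomputable def basis : Module.Basis (Fin 8 ⊕ Root) ℤ IntegralForm :=
  ((Pi.basisFun ℤ (Fin 8)).prod (Finsupp.basisSingleOne (ι := Root) (R := ℤ))).map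
    (AddEquiv.toIntLinearEquiv (AddEquiv.refl (Lattice × (Root →₀ ℤ))))

theorem basis_inl (s : Fin 8) : basis (Sum.inl s) = H (simple s) := by
  simp [basis]; rfl

theorem basis_inr (α : Root) : basis (Sum.inr α) = X α := by
  simp [basis]; rfl

end IntegralForm

open IntegralForm

/-! ### Basis, dimension and invariant form over the field -/

noncomputable instance : Fintype Root := Fintype.ofEquiv _ rootEquiv.symm

theorem card_root : Fintype.card Root = 240 := by
  rw [Fintype.card_congr rootEquiv, Fintype.card_fin]

/-- The Cartan matrix has determinant 1, so the fundamental weights lie in the root lattice. This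
keeps the form nondegenerate on the Cartan subalgebra in every characteristic. -/
theorem exists_dual_lattice_basis :
    ∃ ω : Fin 8 → Lattice, ∀ s t, form (simple s) (ω t) = if s = t then 1 else 0 := by
  have h : IsUnit CartanMatrix.E₈.det := by simp [CartanMatrix.E₈_det]
  refine ⟨fun t s => CartanMatrix.E₈⁻¹ s t, fun s t => ?_⟩
  rw [form, simple, single_one_dotProduct, ← Matrix.one_apply, ← Matrix.mul_nonsing_inv _ h]
  rfl

section

variable (k : Type*) [Field k]

/-- The basis of the Lie algebra over `k`. -/
noncomputable def basis : Module.Basis (Fin 8 ⊕ Root) k (LieAlg k) :=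
  Algebra.TensorProduct.basis k IntegralForm.basis

theorem basis_apply (i : Fin 8 ⊕ Root) : basis k i = 1 ⊗ₜ IntegralForm.basis i :=
  Algebra.TensorProduct.basis_apply _ _

instance : FiniteDimensional k (LieAlg k) := Module.Finite.of_basis (basis k)

theorem finrank_lieAlg : Module.finrank k (LieAlg k) = 248 := by
  rw [Module.finrank_eq_card_basis (basis k), Fintype.card_sum, card_root, Fintype.card_fin]

/-- The invariant form over `k`. -/
noncomputable def bilin : LinearMap.BilinForm k (LieAlg k) :=
  LinearMap.BilinForm.baseChange k pairingForm

theorem bilin_tmul (x y : IntegralForm) :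
    bilin k (1 ⊗ₜ x) (1 ⊗ₜ y) = (pairing x y : k) := by
  simp [bilin, pairingForm_apply]

theorem bilin_isSymm : (bilin k).IsSymm := by
  have h : bilin k = LinearMap.flip (bilin k) :=
    LinearMap.ext_basis (basis k) (basis k) fun i j => by
      rw [LinearMap.flip_apply, basis_apply, basis_apply, bilin_tmul, bilin_tmul, pairing_comm]
  exact ⟨fun x y => LinearMap.congr_fun₂ h x y⟩

theorem bilin_nondegenerate : (bilin k).Nondegenerate := by
  classical
  obtain ⟨ω, hω⟩ := exists_dual_lattice_basis
  -- The dual basis: fundamental weights for the simple coroots, and `-X_{-α}` for `X_α`, the sign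
  -- coming from `(X_α | X_{-α}) = -1`.
  let d : Fin 8 ⊕ Root → LieAlg k :=
    Sum.elim (fun s => 1 ⊗ₜ H (ω s)) (fun α => -(1 ⊗ₜ X (-α)))
  have hd (i : Fin 8 ⊕ Root) : LinearMap.flip (bilin k) (d i) = (basis k).coord i := by
    refine (basis k).ext fun j => ?_
    rw [LinearMap.flip_apply, Module.Basis.coord_apply, Module.Basis.repr_self, basis_apply]
    rcases i with s | α <;> rcases j with t | β
    · simp [d, basis_inl, bilin_tmul, pairing_H_H, hω, Finsupp.single_apply]
    · simp [d, basis_inr, bilin_tmul, pairing_X_H]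
    · simp [d, basis_inl, bilin_tmul, pairing_H_X]
    · have : β.1 + (-α).1 = 0 ↔ β = α := by
        rw [Subtype.ext_iff, ← sub_eq_zero (a := β.1), sub_eq_add_neg]; rfl
      simp only [d, Sum.elim_inr, basis_inr, map_neg, bilin_tmul, pairing_X_X, this,
        Finsupp.single_apply, Sum.inr.injEq]
      split_ifs <;> simp
  refine (bilin_isSymm k).isRefl.nondegenerate_iff_separatingLeft.2 fun x hx => ?_
  rw [← (basis k).forall_coord_eq_zero_iff]
  intro i
  rw [← hd, LinearMap.flip_apply, hx]

theorem bilin_lie (α : Root) (x y : LieAlg k) :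
    bilin k ⁅(1 : k) ⊗ₜ[ℤ] X α, x⁆ y = -bilin k x ⁅(1 : k) ⊗ₜ[ℤ] X α, y⁆ := by
  have key : (bilin k).compLeft (LieAlgebra.ad k (LieAlg k) (1 ⊗ₜ X α))
      = -(bilin k).compRight (LieAlgebra.ad k (LieAlg k) (1 ⊗ₜ X α)) := by
    refine LinearMap.BilinForm.ext_basis (basis k) fun i j => ?_
    simp only [LinearMap.BilinForm.compLeft_apply, LinearMap.neg_apply,
      LinearMap.BilinForm.compRight_apply, LieAlgebra.ad_apply, basis_apply,
      LieAlgebra.ExtendScalars.bracket_tmul, mul_one, bilin_tmul, pairing_bracket_X, Int.cast_neg]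
  exact LinearMap.congr_fun₂ key x y

end

/-! ### Elements of the Lie algebra as bit vectors -/

/-- `force n g` is `g n`; the kernel evaluates `n` to a numeral before it unfolds `g`. -/
def force {α : Type*} (n : ℕ) (g : ℕ → α) : α := Nat.rec (g 0) (fun m _ => g (Nat.succ m)) n

theorem force_eq {α : Type*} (n : ℕ) (g : ℕ → α) : force n g = g n := by cases n <;> rfl

/-- The bit vector of the `i`-th basis vector: bit `64 + i` is set, and the lowest `64` bits are
a fingerprint without mathematical meaning, which keeps hash values of numerals apart. -/
def unit (i : ℕ) : ℕ := 2 ^ 64 * 2 ^ i + (i + 1) ^ 13 % 2 ^ 64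

theorem testBit_unit (i j : ℕ) : (unit i).testBit (64 + j) = decide (i = j) := by
  rw [unit, Nat.testBit_two_pow_mul_add _ (Nat.mod_lt _ (by positivity)), if_neg (by omega),
    Nat.add_sub_cancel_left, Nat.testBit_two_pow]

/-- The bit vector of a coroot. -/
def corootMask (α : Lattice) : ℕ :=
  (List.finRange 8).foldr (fun s n => cond (Int.toNat (α s % 2) == 1) (unit (240 + s) ^^^ n) n) 0

/-- The bit vector of the bracket of a root vector with a basis vector. -/
def bracketMask (α : Lattice) (i : ℕ) : ℕ :=
  if i < 240 then
    if Listed (α + rootVec i) then unit (rootIdx (α + rootVec i))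
    else if ∀ j, (α + rootVec i) j = 0 then corootMask α else 0
  else if form (simple (Fin.ofNat 8 (i - 240))) α % 2 = 1 then unit (rootIdx α) else 0

/-- The bit vector of the bracket of a sum of root vectors with a basis vector. -/
def rowMask (A : List Lattice) (i : ℕ) : ℕ := A.foldr (fun α n => bracketMask α i ^^^ n) 0

/-- The bit vector of a sum of root vectors. -/
def sumMask (A : List Lattice) : ℕ := A.foldr (fun α n => unit (rootIdx α) ^^^ n) 0

section

variable (k : Type*) [Field k]

/-- The vector `X_γ` over `k`, zero if `γ` is not a root. -/
noncomputable def rootElt (γ : Lattice) : LieAlg k := 1 ⊗ₜ V γ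

/-- The basis of the Lie algebra, in the order used for bit vectors. -/
noncomputable def vec (i : ℕ) : LieAlg k :=
  if i < 240 then rootElt k (rootVec i) else 1 ⊗ₜ H (simple (Fin.ofNat 8 (i - 240)))

/-- The element of the Lie algebra given by a bit vector. -/
noncomputable def ofBits (n : ℕ) : LieAlg k :=
  ∑ i ∈ Finset.range 248, if n.testBit (64 + i) then vec k i else 0

theorem ofBits_zero : ofBits k 0 = 0 := by simp [ofBits]

theorem ofBits_unit {i : ℕ} (hi : i < 248) : ofBits k (unit i) = vec k i := by
  simp [ofBits, testBit_unit, hi]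

theorem span_vec : Submodule.span k (vec k '' Set.Iio 248) = ⊤ := by
  rw [eq_top_iff, ← (basis k).span_eq, Submodule.span_le]
  rintro _ ⟨i, rfl⟩
  apply Submodule.subset_span
  rw [basis_apply]
  rcases i with s | α
  · refine ⟨240 + s, by have := s.2; simp; omega, ?_⟩
    rw [vec, if_neg (by omega), basis_inl, Nat.add_sub_cancel_left, Fin.ofNat_val_eq_self]
  · have h := listed α.2
    refine ⟨rootIdx α.1, h.1.trans (by norm_num), ?_⟩
    rw [vec, if_pos h.1, h.rootVec_rootIdx, rootElt, basis_inr, X_eq_V]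

theorem ofBits_unit_rootIdx {γ : Lattice} (h : Listed γ) :
    ofBits k (unit (rootIdx γ)) = rootElt k γ := by
  rw [ofBits_unit k (h.1.trans (by norm_num)), vec, if_pos h.1, h.rootVec_rootIdx]

variable [CharP k 2]

/-- Characteristic 2 enters here: an integral coefficient matters only through its parity. -/
theorem one_tmul_zsmul (n : ℤ) (y : IntegralForm) :
    (1 : k) ⊗ₜ[ℤ] (n • y) = if n % 2 = 1 then 1 ⊗ₜ y else 0 := by
  rw [← TensorProduct.smul_tmul, zsmul_one]
  have h2 : (2 : k) = 0 := CharP.cast_eq_zero k 2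
  rw [← Int.emod_add_mul_ediv n 2]
  push_cast
  rw [h2, zero_mul, add_zero]
  rcases Int.emod_two_eq n with h | h <;> simp [h]

theorem neg_eq (x : LieAlg k) : -x = x := by
  rw [← neg_one_smul k x, CharTwo.neg_eq, one_smul]

theorem add_self_eq (x : LieAlg k) : x + x = 0 := by
  nth_rewrite 1 [← neg_eq k x]
  exact neg_add_cancel x

theorem one_tmul_neg (y : IntegralForm) : (1 : k) ⊗ₜ[ℤ] (-y) = 1 ⊗ₜ y := by
  rw [TensorProduct.tmul_neg, neg_eq]

theorem ofBits_xor (m n : ℕ) : ofBits k (m ^^^ n) = ofBits k m + ofBits k n := by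
  rw [ofBits, ofBits, ofBits, ← Finset.sum_add_distrib]
  refine Finset.sum_congr rfl fun i _ => ?_
  rw [Nat.testBit_xor]
  cases m.testBit (64 + i) <;> cases n.testBit (64 + i) <;> simp [add_self_eq]

theorem ofBits_foldr {ι : Type*} (l : List ι) (g : ι → ℕ) :
    ofBits k (l.foldr (fun i n => g i ^^^ n) 0) = (l.map fun i => ofBits k (g i)).sum := by
  induction l with
  | nil => exact ofBits_zero k
  | cons i l ih => rw [List.foldr_cons, ofBits_xor, ih, List.map_cons, List.sum_cons]

theorem ofBits_corootMask (α : Lattice) : ofBits k (corootMask α) = 1 ⊗ₜ H α := by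
  have h1 : corootMask α = (List.finRange 8).foldr
      (fun s n => (if α s % 2 = 1 then unit (240 + s) else 0) ^^^ n) 0 := by
    rw [corootMask]
    congr 1
    funext s n
    rcases Int.emod_two_eq (α s) with h | h <;> simp [h]
  have h2 : H α = ∑ s, α s • H (simple s) := by
    let φ : Lattice →+ IntegralForm := AddMonoidHom.mk' H H_add
    have : α = ∑ s, α s • simple s := by
      rw [← Finset.univ_sum_single α]
      refine Finset.sum_congr rfl fun s _ => ?_
      simp [simple, ← Pi.single_smul]
    change φ α = ∑ s, α s • φ (simple s)
    conv_lhs => rw [this]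
    simp only [map_sum, map_zsmul]
  rw [h1, ofBits_foldr, h2, TensorProduct.tmul_sum, ← List.sum_ofFn, List.ofFn_eq_map]
  congr 1
  refine List.map_congr_left fun s _ => ?_
  rw [one_tmul_zsmul]
  split_ifs
  · rw [ofBits_unit k (by have := s.2; omega), vec, if_neg (by omega), Nat.add_sub_cancel_left,
      Fin.ofNat_val_eq_self]
  · exact ofBits_zero k

/-- Modulo 2 the signs `ε` become 1, so the bracket of root vectors is the vector of the sum, the
coroot when the roots are opposite, or zero. -/
theorem lie_vec {α : Lattice} (hα : form α α = 2) (i : ℕ) :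
    ⁅rootElt k α, vec k i⁆ = ofBits k (bracketMask α i) := by
  by_cases h : i < 240
  · have hβ := form_rootVec i h
    rw [vec, if_pos h, rootElt, rootElt, LieAlgebra.ExtendScalars.bracket_tmul, mul_one,
      bracketMask, if_pos h]
    by_cases h0 : form α (rootVec i) = -2
    · have e := (add_eq_zero_iff_form hα hβ).2 h0
      -- Listed vectors have norm 2, so the zero vector is not mistaken for a root.
      have hl : ¬ Listed (α + rootVec i) := fun hc => by
        have := form_rootVec _ hc.1
        rw [hc.rootVec_rootIdx, e] at this
        simp [form_zero_right] at this
      rw [if_neg hl, if_pos (show ∀ j, (α + rootVec i) j = 0 from congrFun e),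
        bracket_V_V_neg hα hβ h0, one_tmul_neg, ofBits_corootMask]
    · rw [bracket_V_V hα hβ h0]
      have hs : (1 : k) ⊗ₜ[ℤ] (sign α (rootVec i) • V (α + rootVec i)) =
          rootElt k (α + rootVec i) := by
        rw [one_tmul_zsmul, if_pos]; · rfl
        rcases mul_self_eq_one_iff.1 (sign_mul_self α (rootVec i)) with h | h <;> rw [h] <;> rfl
      rw [hs]
      by_cases hl : Listed (α + rootVec i)
      · rw [if_pos hl, ofBits_unit_rootIdx k hl]
      · rw [if_neg hl, if_neg (show ¬ ∀ j, (α + rootVec i) j = 0 from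
          fun hc => h0 ((add_eq_zero_iff_form hα hβ).1 (funext hc))),
          ofBits_zero, rootElt, V_eq_zero fun hc => hl (listed hc), TensorProduct.tmul_zero]
  · rw [vec, if_neg h, rootElt, LieAlgebra.ExtendScalars.bracket_tmul, mul_one, bracketMask,
      if_neg h, bracket_V_H, one_tmul_neg, one_tmul_zsmul]
    split_ifs
    · rw [ofBits_unit_rootIdx k (listed hα), rootElt]
    · rw [ofBits_zero]

theorem lie_sum_vec {A : List Lattice} (hA : ∀ α ∈ A, form α α = 2) (i : ℕ) :
    ⁅(A.map (rootElt k)).sum, vec k i⁆ = ofBits k (rowMask A i) := by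
  rw [rowMask, ofBits_foldr]
  induction A with
  | nil => exact zero_lie _
  | cons α A ih =>
    rw [List.map_cons, List.sum_cons, add_lie, ih fun β hβ => hA β (List.mem_cons_of_mem _ hβ),
      lie_vec k (hA α List.mem_cons_self)]
    rfl

theorem ofBits_sumMask {A : List Lattice} (hA : ∀ α ∈ A, form α α = 2) :
    ofBits k (sumMask A) = (A.map (rootElt k)).sum := by
  rw [sumMask, ofBits_foldr]
  exact congrArg List.sum
    (List.map_congr_left fun α hα => ofBits_unit_rootIdx k (listed (hA α hα)))

/-- The sign separating `e_α` from `X_α` disappears in characteristic 2. -/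
theorem e_eq (α : Root) : e k α = rootElt k α.1 := by
  rw [e, IntegralForm.e, rootElt]
  split_ifs
  · rw [X_eq_V]
  · rw [one_tmul_neg, X_eq_V]

end

/-! ### Linear algebra on bit vectors -/

/-- `k (l.map g)`, with the entries of the list evaluated. -/
def forceMap {α : Type*} (g : ℕ → ℕ) (l : List ℕ) : (List ℕ → α) → α :=
  List.rec (fun k => k []) (fun i _ ih k => force (g i) fun r => ih fun rs => k (r :: rs)) l

theorem forceMap_eq {α : Type*} (g : ℕ → ℕ) (l : List ℕ) (k : List ℕ → α) :
    forceMap g l k = k (l.map g) := by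
  induction l generalizing k with
  | nil => rfl
  | cons i l ih =>
    change force (g i) (fun r => forceMap g l fun rs => k (r :: rs)) = _
    rw [force_eq, ih]
    rfl

/-- `xor` of the entries of `rows` at the positions where the bit of `n`, counted from `i`, is
set. -/
def applyFrom (rows : List ℕ) (n i : ℕ) : ℕ :=
  List.rec (fun _ => 0) (fun r _ ih i => force (Nat.succ i) fun j =>
    cond (n.testBit i) (Nat.xor (ih j) r) (ih j)) rows i

theorem applyFrom_cons (r : ℕ) (rows : List ℕ) (n i : ℕ) : applyFrom (r :: rows) n i =
    cond (n.testBit i) (applyFrom rows n (i + 1) ^^^ r) (applyFrom rows n (i + 1)) :=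
  rfl

/-- The linear map with the given columns. -/
def applyRows (rows : List ℕ) (n : ℕ) : ℕ := applyFrom rows n 64

/-- Reduction of a bit vector by an echelon list. -/
def reduce (n : ℕ) (l : List ℕ) : ℕ :=
  List.rec n (fun p _ ih => force ih fun m => force (Nat.xor m p) fun a => cond (Nat.ble m a) m a) l

/-- For nonzero `p`, adding `p` makes a number smaller exactly when the leading bit of `p` is set in
it. Keeping the smaller of the two is therefore elimination at that bit. -/
theorem reduce_cons (n p : ℕ) (l : List ℕ) : reduce n (p :: l) =
    cond (Nat.ble (reduce n l) (reduce n l ^^^ p)) (reduce n l) (reduce n l ^^^ p) :=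
  (force_eq (reduce n l) fun m => force (Nat.xor m p) fun a => cond (Nat.ble m a) m a).trans
    (force_eq _ _)

/-- The composite of two linear maps along a word. -/
def applyWord (rE rF : List ℕ) (w : List Bool) (n : ℕ) : ℕ :=
  List.rec n (fun c _ ih => force ih fun m => applyRows (cond c rE rF) m) w

/-- Extends `ech` to an echelon list that also spans the images of the vectors of `queue` under
all words in two linear maps; `K` is applied to the result. -/
def spin (rE rF : List ℕ) (fuel : ℕ) : List ℕ → List ℕ → (List ℕ → Bool) → Bool :=
  Nat.rec (fun _ ech K => K ech) (fun _ ih queue ech K =>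
    List.rec (K ech) (fun n rest _ => force (reduce n ech) fun r =>
      cond (Nat.beq r 0) (ih rest ech K)
        (force (applyRows rE r) fun a => force (applyRows rF r) fun b =>
          ih (a :: b :: rest) (r :: ech) K)) queue) fuel

theorem spin_cons (rE rF : List ℕ) (fuel n : ℕ) (rest ech : List ℕ) (K : List ℕ → Bool) :
    spin rE rF (fuel + 1) (n :: rest) ech K =
      cond (Nat.beq (reduce n ech) 0) (spin rE rF fuel rest ech K)
        (spin rE rF fuel (applyRows rE (reduce n ech) :: applyRows rF (reduce n ech) :: rest)
          (reduce n ech :: ech) K) := by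
  refine (force_eq (reduce n ech) fun r => cond (Nat.beq r 0) (spin rE rF fuel rest ech K)
    (force (applyRows rE r) fun a => force (applyRows rF r) fun b =>
      spin rE rF fuel (a :: b :: rest) (r :: ech) K)).trans ?_
  rw [force_eq, force_eq]

section

variable (k : Type*) [Field k] [CharP k 2]

theorem ofBits_applyFrom (rows : List ℕ) (n i : ℕ) : ofBits k (applyFrom rows n i) =
    ∑ j ∈ Finset.range rows.length,
      if n.testBit (i + j) then ofBits k (rows.getD j 0) else 0 := by
  induction rows generalizing i with
  | nil => exact ofBits_zero k
  | cons r rows ih =>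
    rw [applyFrom_cons, List.length_cons, Finset.sum_range_succ', add_zero, List.getD_cons_zero]
    simp only [List.getD_cons_succ]
    have h' := ih (i + 1)
    simp only [add_assoc, add_comm 1] at h'
    cases n.testBit i
    · simpa using h'
    · simp [ofBits_xor, h']

theorem ofBits_applyRows {x : LieAlg k} {rows : List ℕ} (hl : rows.length = 248)
    (h : ∀ i < 248, ⁅x, vec k i⁆ = ofBits k (rows.getD i 0)) (n : ℕ) :
    ofBits k (applyRows rows n) = ⁅x, ofBits k n⁆ := by
  rw [applyRows, ofBits_applyFrom, hl, ofBits]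
  change _ = LieAlgebra.ad k (LieAlg k) x _
  rw [map_sum]
  refine Finset.sum_congr rfl fun i hi => ?_
  split_ifs
  · rw [LieAlgebra.ad_apply, h i (Finset.mem_range.1 hi)]
  · rw [map_zero]

/-- Each reduction step changes the vector by an element of `U` or not at all, whichever branch is
taken. Soundness therefore does not need the list to be in echelon form. -/
theorem ofBits_reduce_mem_iff {U : Submodule k (LieAlg k)} {l : List ℕ}
    (hl : ∀ p ∈ l, ofBits k p ∈ U) (n : ℕ) : ofBits k (reduce n l) ∈ U ↔ ofBits k n ∈ U := by
  induction l with
  | nil => rfl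
  | cons p l ih =>
    rw [reduce_cons, ← ih fun q hq => hl q (List.mem_cons_of_mem _ hq)]
    cases Nat.ble (reduce n l) (reduce n l ^^^ p)
    · rw [cond_false, ofBits_xor, U.add_mem_iff_left (hl p List.mem_cons_self)]
    · rfl

theorem ofBits_mem_of_reduce {U : Submodule k (LieAlg k)} {l : List ℕ}
    (hl : ∀ p ∈ l, ofBits k p ∈ U) {n : ℕ} (h : reduce n l = 0) : ofBits k n ∈ U := by
  rw [← ofBits_reduce_mem_iff k hl, h, ofBits_zero]
  exact U.zero_mem

variable {k} {x y : LieAlg k} {rE rF : List ℕ}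

omit [CharP k 2] in
theorem ofBits_applyWord (hE : ∀ n, ofBits k (applyRows rE n) = ⁅x, ofBits k n⁆)
    (hF : ∀ n, ofBits k (applyRows rF n) = ⁅y, ofBits k n⁆) (w : List Bool) (n : ℕ) :
    ofBits k (applyWord rE rF w n) = adWord k x y w (ofBits k n) := by
  induction w with
  | nil => rfl
  | cons c w ih =>
    have h : applyWord rE rF (c :: w) n = applyRows (cond c rE rF) (applyWord rE rF w n) :=
      force_eq _ _
    rw [h]
    cases c
    · rw [cond_false, hF, ih]; rfl
    · rw [cond_true, hE, ih]; rfl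

/-- Only soundness of spinning is recorded: the vectors found lie in every stable subspace that
contains the input. That they span enough is left to the test `K`. -/
theorem exists_of_spin (hE : ∀ n, ofBits k (applyRows rE n) = ⁅x, ofBits k n⁆)
    (hF : ∀ n, ofBits k (applyRows rF n) = ⁅y, ofBits k n⁆) {fuel : ℕ} {queue ech : List ℕ}
    {K : List ℕ → Bool} (h : spin rE rF fuel queue ech K = true) :
    ∃ l, K (l ++ ech) = true ∧ ∀ U : Submodule k (LieAlg k), Stable x y U →
      (∀ n ∈ queue, ofBits k n ∈ U) → (∀ n ∈ ech, ofBits k n ∈ U) → ∀ n ∈ l, ofBits k n ∈ U := by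
  induction fuel generalizing queue ech with
  -- Running out of fuel is harmless, since the list collected so far is still sound.
  | zero => exact ⟨[], h, by simp⟩
  | succ fuel ih =>
    rcases queue with _ | ⟨n, rest⟩
    · exact ⟨[], h, by simp⟩
    · rw [spin_cons] at h
      cases hc : Nat.beq (reduce n ech) 0
      · rw [hc, cond_false] at h
        obtain ⟨l, hl, hU⟩ := ih h
        refine ⟨l ++ [reduce n ech], by simpa using hl, fun U hs hq he => ?_⟩
        have hr : ofBits k (reduce n ech) ∈ U :=
          (ofBits_reduce_mem_iff k he n).2 (hq n List.mem_cons_self)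
        have := hU U hs
          (by
            simp only [List.mem_cons, forall_eq_or_imp]
            exact ⟨hE _ ▸ (hs _ hr).1, hF _ ▸ (hs _ hr).2,
              fun m hm => hq m (List.mem_cons_of_mem _ hm)⟩)
          (by
            simp only [List.mem_cons, forall_eq_or_imp]
            exact ⟨hr, he⟩)
        simp only [List.mem_append, List.mem_singleton]
        rintro m (hm | rfl)
        · exact this m hm
        · exact hr
      · rw [hc, cond_true] at h
        obtain ⟨l, hl, hU⟩ := ih h
        exact ⟨l, hl, fun U hs hq he =>
          hU U hs (fun m hm => hq m (List.mem_cons_of_mem _ hm)) he⟩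

end

/-! ### The finite certificate and its consequences -/

/-- The computation behind the theorem, for the matrices of `ad e` and `ad f`, the bit vectors of
`e` and `f` and a word of rank one. -/
def check (rE rF : List ℕ) (eM fM : ℕ) (w : List Bool) : Bool :=
  -- Every new vector puts two more in the queue, so 124 new vectors after at most two initial ones
  -- take at most 250 rounds; 300 is enough for each of the three runs.
  spin rE rF 300 [eM, fM] [] fun ls =>
    (Nat.beq ls.length 124 && Nat.beq (reduce eM ls) 0 && Nat.beq (reduce fM ls) 0
      && Nat.beq (reduce (unit 239) ls) 0
      && ls.all fun l => Nat.beq (reduce (applyRows rE l) ls) 0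
        && Nat.beq (reduce (applyRows rF l) ls) 0
        -- The highest root has position 119 and the lowest 239; a vanishing coefficient at 119
        -- means orthogonality to the lowest root vector.
        && !l.testBit (64 + 119)
        && force (applyWord rE rF w l) fun a => Nat.beq a 0 || Nat.beq a (unit 239))
    && spin rE rF 300 [unit 239] [] (fun us =>
      Nat.beq (reduce eM us) 0 && Nat.beq (reduce fM us) 0)
    && spin rE rF 300 [applyWord rE rF w.reverse (unit 119)] ls fun us =>
      Nat.beq us.length 248 && (List.range 248).all fun i => Nat.beq (reduce (unit i) us) 0

/-- `check` for two sums of root vectors. -/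
def checkSums (A A' : List Lattice) (w : List Bool) : Bool :=
  forceMap (rowMask A) (List.range 248) fun rE => forceMap (rowMask A') (List.range 248) fun rF =>
    force (sumMask A) fun eM => force (sumMask A') fun fM => check rE rF eM fM w

section

variable {k : Type*} [Field k]

theorem bilin_lie_sum {A : List Lattice} (hA : ∀ α ∈ A, form α α = 2) (x y : LieAlg k) :
    bilin k ⁅(A.map (rootElt k)).sum, x⁆ y = -bilin k x ⁅(A.map (rootElt k)).sum, y⁆ := by
  induction A with
  | nil =>
    change bilin k ⁅(0 : LieAlg k), x⁆ y = -bilin k x ⁅(0 : LieAlg k), y⁆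
    rw [zero_lie, zero_lie, map_zero, map_zero, LinearMap.zero_apply, neg_zero]
  | cons α A ih =>
    have h := bilin_lie k ⟨α, hA α List.mem_cons_self⟩ x y
    rw [X_eq_V] at h
    rw [List.map_cons, List.sum_cons, add_lie, add_lie, map_add, map_add, LinearMap.add_apply,
      ih fun β hβ => hA β (List.mem_cons_of_mem _ hβ), rootElt, h, neg_add]

theorem rootVec_add_ne_zero : ∀ i < 240, i ≠ 119 → rootVec 239 + rootVec i ≠ 0 := by
  decide +kernel

/-- Among the basis vectors, only the highest root vector pairs nontrivially with the lowest. -/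
theorem bilin_vec_ofBits {n : ℕ} (h : n.testBit (64 + 119) = false) :
    bilin k (vec k 239) (ofBits k n) = 0 := by
  rw [ofBits, map_sum]
  refine Finset.sum_eq_zero fun i _ => ?_
  by_cases hi : i = 119
  · rw [hi, h]; exact map_zero _
  · split_ifs
    · rw [vec, if_pos (by norm_num), vec, rootElt]
      split_ifs with h'
      · rw [rootElt, bilin_tmul, pairing_V_V_zero (rootVec_add_ne_zero i h' hi), Int.cast_zero]
      · rw [bilin_tmul, pairing_comm, pairing_H_V, Int.cast_zero]
    · exact map_zero _

variable (k) in
/-- The span of the elements given by a list of bit vectors. -/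
noncomputable def spanBits (l : List ℕ) : Submodule k (LieAlg k) :=
  Submodule.span k (ofBits k '' {n | n ∈ l})

theorem mem_spanBits {l : List ℕ} {n : ℕ} (h : n ∈ l) : ofBits k n ∈ spanBits k l :=
  Submodule.subset_span ⟨n, h, rfl⟩

theorem spanBits_le {l : List ℕ} {U : Submodule k (LieAlg k)} (h : ∀ n ∈ l, ofBits k n ∈ U) :
    spanBits k l ≤ U := by
  rw [spanBits, Submodule.span_le]
  rintro _ ⟨n, hn, rfl⟩
  exact h n hn

theorem finrank_spanBits_le (l : List ℕ) : Module.finrank k (spanBits k l) ≤ l.length := by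
  classical
  have h : ofBits k '' {n | n ∈ l} = ((l.map (ofBits k)).toFinset : Set (LieAlg k)) := by
    ext; simp
  rw [spanBits, h]
  refine (finrank_span_finset_le_card _).trans ((List.toFinset_card_le _).trans ?_)
  rw [List.length_map]

variable [CharP k 2]

/-- Here `ls` spans `L`, `us` certifies that the lowest root vector generates `L`, and `vs`
complements `ls` to a spanning set of the whole algebra. -/
theorem lieSpan_of_check {x y : LieAlg k} {rE rF : List ℕ} {eM fM : ℕ} {w : List Bool}
    (hE : ∀ n, ofBits k (applyRows rE n) = ⁅x, ofBits k n⁆)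
    (hF : ∀ n, ofBits k (applyRows rF n) = ⁅y, ofBits k n⁆)
    (he : ofBits k eM = x) (hf : ofBits k fM = y) (hB : Skew (bilin k) x y)
    (h : check rE rF eM fM w = true) {L : LieSubalgebra k (LieAlg k)}
    (hL : L = LieSubalgebra.lieSpan k (LieAlg k) {x, y}) :
    IsCoatom L ∧ Module.finrank k L = 124 ∧
      LieModule.IsIrreducible k L (LieAlg k ⧸ L.toLieSubmodule) := by
  have hLs : Stable x y L.toSubmodule := hL ▸ stable_lieSpan
  have hLle {U : Submodule k (LieAlg k)} (hU : Stable x y U) (hx : x ∈ U) (hy : y ∈ U) :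
      L.toSubmodule ≤ U := hL ▸ hU.lieSpan_le hx hy
  have hxL : x ∈ L.toSubmodule := hL ▸ LieSubalgebra.subset_lieSpan (by simp)
  have hyL : y ∈ L.toSubmodule := hL ▸ LieSubalgebra.subset_lieSpan (by simp)
  obtain ⟨ls, h, hls⟩ := exists_of_spin hE hF h
  rw [List.append_nil] at h
  simp only [Bool.and_eq_true, List.all_eq_true, Bool.not_eq_true', Bool.or_eq_true,
    Nat.beq_eq, force_eq] at h
  obtain ⟨⟨⟨⟨⟨⟨hlen, hre⟩, hrf⟩, hrv⟩, hall⟩, hu⟩, hv⟩ := h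
  obtain ⟨us, hu, hus⟩ := exists_of_spin hE hF hu
  obtain ⟨vs, hv, hvs⟩ := exists_of_spin hE hF hv
  simp only [Bool.and_eq_true, List.all_eq_true, List.mem_range, List.append_nil,
    Nat.beq_eq] at hu hv
  have hlsL : ∀ l ∈ ls, ofBits k l ∈ L.toSubmodule :=
    hls _ hLs (by simpa [he, hf] using ⟨hxL, hyL⟩) (by simp)
  -- the Lie subalgebra is spanned by the vectors in `ls`
  have hlsS : ∀ l ∈ ls, ofBits k l ∈ spanBits k ls := fun l hl => mem_spanBits hl
  have hSs : Stable x y (spanBits k ls) := by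
    intro z hz
    have h1 : spanBits k ls ≤ (spanBits k ls).comap (LieAlgebra.ad k (LieAlg k) x) := spanBits_le fun l hl => by
      change ⁅x, ofBits k l⁆ ∈ spanBits k ls
      rw [← hE]
      exact ofBits_mem_of_reduce k hlsS (hall l hl).1.1.1
    have h2 : spanBits k ls ≤ (spanBits k ls).comap (LieAlgebra.ad k (LieAlg k) y) := spanBits_le fun l hl => by
      change ⁅y, ofBits k l⁆ ∈ spanBits k ls
      rw [← hF]
      exact ofBits_mem_of_reduce k hlsS (hall l hl).1.1.2
    exact ⟨h1 hz, h2 hz⟩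
  have hLS : L.toSubmodule = spanBits k ls := by
    refine le_antisymm (hLle hSs ?_ ?_) (spanBits_le hlsL)
    · exact he ▸ ofBits_mem_of_reduce k hlsS hre
    · exact hf ▸ ofBits_mem_of_reduce k hlsS hrf
  have hvec : ofBits k (unit 239) = vec k 239 := ofBits_unit k (by norm_num)
  -- the lowest root vector generates the Lie subalgebra
  have hgen {U : Submodule k (LieAlg k)} (hU : Stable x y U) (hm : vec k 239 ∈ U) :
      L.toSubmodule ≤ U := by
    have h := hus U hU (by simpa [hvec] using hm) (by simp)
    exact hLle hU (he ▸ ofBits_mem_of_reduce k h hu.1) (hf ▸ ofBits_mem_of_reduce k h hu.2)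
  have hspan {U : Submodule k (LieAlg k)} (hU : ∀ n ∈ vs ++ ls, ofBits k n ∈ U) : U = ⊤ := by
    rw [eq_top_iff, ← span_vec k, Submodule.span_le]
    rintro _ ⟨i, hi, rfl⟩
    rw [← ofBits_unit k hi]
    exact ofBits_mem_of_reduce k hU (hv.2 i hi)
  -- Linear independence is never tested. The upper bound counts `ls`; the lower bound holds because
  -- the 124 vectors of `vs` and `L` together span a space of dimension 248.
  have hdim : Module.finrank k L.toSubmodule = 124 := by
    refine le_antisymm ?_ ?_
    · rw [hLS, ← hlen]
      exact finrank_spanBits_le ls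
    · have hR := finrank_spanBits_le (k := k) vs
      have hl := hv.1
      rw [List.length_append, hlen] at hl
      have htop : spanBits k vs ⊔ L.toSubmodule = ⊤ := hspan fun n hn => by
        rcases List.mem_append.1 hn with hn | hn
        · exact Submodule.mem_sup_left (mem_spanBits hn)
        · exact Submodule.mem_sup_right (hlsL n hn)
      have := Submodule.finrank_add_le_finrank_add_finrank (spanBits k vs) L.toSubmodule
      rw [htop, finrank_top, finrank_lieAlg] at this
      omega
  have hperp : (bilin k).orthogonal L.toSubmodule = L.toSubmodule := by
    symm
    -- Since `Lᗮ` is stable, it contains `L` as soon as it contains the generator `vec k 239`;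
    -- equality follows from `248 - 124 = 124`.
    refine Submodule.eq_of_le_of_finrank_eq (hgen (hB.stable_orthogonal hLs) ?_) ?_
    · rw [LinearMap.BilinForm.mem_orthogonal_iff]
      have : spanBits k ls ≤ LinearMap.ker (bilin k (vec k 239)) :=
        spanBits_le fun l hl => bilin_vec_ofBits (hall l hl).1.2
      exact fun l hl => (bilin_isSymm k).isRefl _ _ (this (hLS ▸ hl))
    · rw [LinearMap.BilinForm.finrank_orthogonal (bilin_nondegenerate k), hdim, finrank_lieAlg]
  have hrank : ∀ l ∈ L.toSubmodule, adWord k x y w l ∈ k ∙ vec k 239 := by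
    have : spanBits k ls ≤ (k ∙ vec k 239).comap (adWord k x y w) := spanBits_le fun l hl => by
      rw [Submodule.mem_comap, ← ofBits_applyWord hE hF]
      rcases (hall l hl).2 with h | h <;> rw [h]
      · rw [ofBits_zero]; exact Submodule.zero_mem _
      · rw [hvec]; exact Submodule.mem_span_singleton_self _
    exact fun l hl => this (hLS ▸ hl)
  -- Modulo `L`, the reversed word applied to the highest root vector generates the whole quotient.
  have hcogen (U : Submodule k (LieAlg k)) (hU : Stable x y U) (hLU : L.toSubmodule ≤ U)
      (hm : adWord k x y w.reverse (vec k 119) ∈ U) : U = ⊤ := by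
    refine hspan fun n hn => ?_
    rcases List.mem_append.1 hn with hn | hn
    · refine hvs U hU ?_ (fun l hl => hLU (hlsL l hl)) n hn
      simpa [ofBits_applyWord hE hF, ofBits_unit k (show 119 < 248 by norm_num)] using hm
    · exact hLU (hlsL n hn)
  have htop : L ≠ ⊤ := fun h => by
    have := finrank_lieAlg k
    rw [h, LieSubalgebra.top_toSubmodule, finrank_top] at hdim
    omega
  have := isCoatom_and_isIrreducible hL htop fun U hU hLU =>
    stable_eq_or_eq_top hB (bilin_nondegenerate k) (bilin_isSymm k) hperp hrank
      (fun U hU hm => hgen hU hm) hcogen hU hLU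
  exact ⟨this.1, hdim, this.2⟩

theorem lieSpan_of_checkSums {A A' : List Lattice} {w : List Bool}
    (hA : ∀ α ∈ A, form α α = 2) (hA' : ∀ α ∈ A', form α α = 2)
    (h : checkSums A A' w = true) {L : LieSubalgebra k (LieAlg k)}
    (hL : L = LieSubalgebra.lieSpan k (LieAlg k)
      {(A.map (rootElt k)).sum, (A'.map (rootElt k)).sum}) :
    IsCoatom L ∧ Module.finrank k L = 124 ∧
      LieModule.IsIrreducible k L (LieAlg k ⧸ L.toLieSubmodule) := by
  rw [checkSums, forceMap_eq, forceMap_eq, force_eq, force_eq] at h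
  have hrow {A : List Lattice} (hA : ∀ α ∈ A, form α α = 2) (n : ℕ) :
      ofBits k (applyRows ((List.range 248).map (rowMask A)) n)
        = ⁅(A.map (rootElt k)).sum, ofBits k n⁆ := by
    refine ofBits_applyRows k (by simp) (fun i hi => ?_) n
    rw [lie_sum_vec k hA, List.getD_eq_getElem _ _ (by simpa using hi), List.getElem_map,
      List.getElem_range]
  exact lieSpan_of_check (hrow hA) (hrow hA') (ofBits_sumMask k hA) (ofBits_sumMask k hA')
    (fun x y => ⟨bilin_lie_sum hA x y, bilin_lie_sum hA' x y⟩) h hL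

end

/-! ### The two generating pairs -/

/-- The roots in `e₁`. -/
def support₁ : List Lattice :=
  [![1, 0, 0, 0, 0, 0, 0, 0], ![0, 1, 0, 0, 0, 0, 0, 0], ![0, 0, 1, 0, 0, 0, 0, 0],
   ![0, 1, 0, 1, 0, 0, 0, 0], ![0, 0, 0, 1, 1, 0, 0, 0], ![0, 0, 0, 0, 1, 1, 0, 0],
   ![0, 0, 0, 0, 0, 1, 1, 0], ![0, 0, 0, 0, 0, 0, 0, 1]]

/-- The roots in `f₁`. -/
def cosupport₁ : List Lattice :=
  [-![1, 1, 2, 2, 2, 1, 1, 0], -![1, 1, 1, 2, 2, 1, 1, 1], -![1, 1, 2, 3, 2, 1, 1, 0],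
   -![1, 1, 2, 2, 2, 2, 1, 0], -![1, 1, 2, 2, 1, 1, 1, 1], -![1, 2, 2, 3, 2, 1, 0, 0],
   -![0, 1, 1, 2, 2, 2, 2, 1]]

/-- The roots in `e₂`. -/
def support₂ : List Lattice :=
  [![1, 0, 1, 0, 0, 0, 0, 0], ![0, 1, 0, 1, 0, 0, 0, 0], ![0, 0, 1, 1, 0, 0, 0, 0],
   ![0, 0, 0, 1, 1, 0, 0, 0], ![0, 0, 0, 0, 1, 1, 0, 0], ![0, 0, 0, 0, 0, 1, 1, 0],
   ![0, 0, 0, 0, 0, 0, 1, 1], ![0, 0, 1, 1, 1, 0, 0, 0]]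

/-- The roots in `f₂`. -/
def cosupport₂ : List Lattice :=
  [-![1, 1, 2, 3, 2, 2, 1, 1], -![2, 2, 3, 4, 3, 2, 2, 1], -![1, 2, 3, 4, 3, 3, 2, 1],
   -![1, 2, 2, 4, 4, 3, 2, 1]]

theorem form_support : ∀ α ∈ support₁ ++ cosupport₁ ++ support₂ ++ cosupport₂, form α α = 2 := by
  decide +kernel

/-- The rightmost letter acts first, so the word is `ad f (ad e)² (ad f)³`. It serves as a witness:
the evaluation confirms that it maps `L` into the line of the lowest root vector. It cannot vanish
on `L`, for otherwise its reverse would send the highest root vector into `Lᗮ = L`, and the last run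
would not fill the algebra. -/
theorem checkSums₁ : checkSums support₁ cosupport₁
    [false, true, true, false, false, false] = true := by
  decide +kernel

/-- The witness here is `ad f (ad e)⁴ ad f ad e ad f`. -/
theorem checkSums₂ : checkSums support₂ cosupport₂
    [false, true, true, true, true, false, true, false] = true := by
  decide +kernel

section

variable (k : Type*) [Field k] [CharP k 2]

theorem e₁_eq : e₁ k = (support₁.map (rootElt k)).sum := by
  simp [e₁, e_eq, support₁, root, add_assoc]

theorem f₁_eq : f₁ k = (cosupport₁.map (rootElt k)).sum := by
  simp only [f₁, f, e_eq, cosupport₁, List.map_cons, List.sum_cons, List.map_nil, List.sum_nil,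
    add_zero, add_assoc]
  rfl

theorem e₂_eq : e₂ k = (support₂.map (rootElt k)).sum := by
  simp [e₂, e_eq, support₂, root, add_assoc]

theorem f₂_eq : f₂ k = (cosupport₂.map (rootElt k)).sum := by
  simp only [f₂, f, e_eq, cosupport₂, List.map_cons, List.sum_cons, List.map_nil, List.sum_nil,
    add_zero, add_assoc]
  rfl

end

end E8

theorem mainTheorem12 (k : Type*) [Field k] [IsAlgClosed k] [CharP k 2] :
    (IsCoatom (E8.L₁ k) ∧ Module.finrank k (E8.L₁ k) = 124 ∧
      LieModule.IsIrreducible k (E8.L₁ k) (E8.LieAlg k ⧸ (E8.L₁ k).toLieSubmodule)) ∧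
    (IsCoatom (E8.L₂ k) ∧ Module.finrank k (E8.L₂ k) = 124 ∧
      LieModule.IsIrreducible k (E8.L₂ k) (E8.LieAlg k ⧸ (E8.L₂ k).toLieSubmodule)) := by
  have h := E8.form_support
  simp only [List.mem_append] at h
  refine ⟨E8.lieSpan_of_checkSums (fun α hα => h α (by tauto)) (fun α hα => h α (by tauto))
    E8.checkSums₁ ?_, E8.lieSpan_of_checkSums (fun α hα => h α (by tauto))
    (fun α hα => h α (by tauto)) E8.checkSums₂ ?_⟩
  · rw [E8.L₁, E8.e₁_eq, E8.f₁_eq]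
  · rw [E8.L₂, E8.e₂_eq, E8.f₂_eq]
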